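/- **Conventions.** All Hilbert spaces are complex, $\mathbb D$ is the open unit disk, and $\mathcal L(\mathcal U,\mathcal Y)$ is the space of bounded operators. The Schur class $\mathcal S(\mathcal U,\mathcal Y)$ consists of the analytic functions $S:\mathbb D\to\mathcal L(\mathcal U,\mathcal Y)$ with contractive values. For such $S$, $\mathcal H(K_S)$ is the reproducing kernel Hilbert space of $\mathcal Y$-valued functions on $\mathbb D$ with the positive kernel $K_S(z,\zeta)=\frac{I-S(z)S(\zeta)^*}{1-z\bar\zeta}$. **Data.** Let $\mathcal X,\mathcal U,\mathcal Y$ be Hilbert spaces and $P,T\in\mathcal L(\mathcal X)$, $E\in\mathcal L(\mathcal X,\mathcal Y)$, $N\in\mathcal L(\mathcal X,\mathcal U)$. Assume that for every $x\in\mathcal X$ the functions $E(I-zT)^{-1}x=\sum_{n\ge0}z^nET^nx$ and $N(I-zT)^{-1}x=\sum_{n\ge0}z^nNT^nx$ are analytic on $\mathbb D$ (understood through these power series), that $P\ge0$, and that $P-T^*PT=E^*E-N^*N$ (the data are admissible). For $S\in\mathcal S(\mathcal U,\mathcal Y)$ put $F^S(z)=(E-S(z)N)(I-zT)^{-1}$,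 that is, $F^S(z)x=\sum_{n\ge0}z^nET^nx-S(z)\sum_{n\ge0}z^nNT^nx$. **Construction of $\Sigma$.** Let $\mathcal X_0=\overline{\operatorname{Ran}}\,P^{1/2}$, let $$\mathcal D_V=\overline{\operatorname{Ran}}\begin{bmatrix}P^{1/2}\\N\end{bmatrix}\subseteq\mathcal X_0\oplus\mathcal U,\qquad \mathcal R_V=\overline{\operatorname{Ran}}\begin{bmatrix}P^{1/2}T\\E\end{bmatrix}\subseteq\mathcal X_0\oplus\mathcal Y,$$ and let $V:\mathcal D_V\to\mathcal R_V$ be the unitary operator with $V\begin{bmatrix}P^{1/2}x\\Nx\end{bmatrix}=\begin{bmatrix}P^{1/2}Tx\\Ex\end{bmatrix}$ for all $x\in\mathcal X$. Put $\Delta=(\mathcal X_0\oplus\mathcal U)\ominus\mathcal D_V$ and $\Delta_*=(\mathcal X_0\oplus\mathcal Y)\ominus\mathcal R_V$, and let $\mathbf i:\Delta\to\widetilde\Delta$ and $\mathbf i_*:\Delta_*\to\widetilde\Delta_*$ be unitary maps onto Hilbert spaces $\widetilde\Delta$, $\widetilde\Delta_*$. Let $\mathbf U$ be the unitary operator from $\mathcal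 X_0\oplus\mathcal U\oplus\widetilde\Delta_*=\mathcal D_V\oplus\Delta\oplus\widetilde\Delta_*$ onto $\mathcal X_0\oplus\mathcal Y\oplus\widetilde\Delta=\mathcal R_V\oplus\Delta_*\oplus\widetilde\Delta$ that equals $V$ on $\mathcal D_V$, $\mathbf i$ on $\Delta$ and $\mathbf i_*^*$ on $\widetilde\Delta_*$, and write $$\mathbf U=\begin{bmatrix}A&B_1&B_2\\C_1&D_{11}&D_{12}\\C_2&D_{21}&0\end{bmatrix},\qquad \Sigma(z)=\begin{bmatrix}\Sigma_{11}(z)&\Sigma_{12}(z)\\\Sigma_{21}(z)&\Sigma_{22}(z)\end{bmatrix}=\begin{bmatrix}D_{11}&D_{12}\\D_{21}&0\end{bmatrix}+z\begin{bmatrix}C_1\\C_2\end{bmatrix}(I-zA)^{-1}\begin{bmatrix}B_1&B_2\end{bmatrix}.$$ For $\mathcal E\in\mathcal S(\widetilde\Delta,\widetilde\Delta_*)$ let $$\mathcal R_\Sigma[\mathcal E]=\Sigma_{11}+\Sigma_{12}(I-\mathcal E\Sigma_{22})^{-1}\mathcal E\Sigma_{21},\qquad G=\Sigma_{12}(I-\mathcal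 E\Sigma_{22})^{-1}.$$ **Theorem.** Assume that $T^*$ is injective. Then $\mathcal R_\Sigma$ is a well-defined injective map from $\mathcal S(\widetilde\Delta,\widetilde\Delta_*)$ to $\mathcal S(\mathcal U,\mathcal Y)$ (all the inverses above exist for every $z\in\mathbb D$). Moreover, for every $\mathcal E\in\mathcal S(\widetilde\Delta,\widetilde\Delta_*)$, with $S=\mathcal R_\Sigma[\mathcal E]$, the kernels $K_{\mathcal E}$ and $K_S$ are positive, $M_G:h\mapsto Gh$ is a bounded operator from $\mathcal H(K_{\mathcal E})$ to $\mathcal H(K_S)$, $M_{F^S}:x\mapsto F^S(\cdot)x$ is a bounded operator from $\mathcal X$ to $\mathcal H(K_S)$, and $M_G$ has trivial kernel. If in addition $P=M_{F^S}^{[*]}M_{F^S}$, where $M_{F^S}^{[*]}$ is the adjoint with respect to the inner product of $\mathcal H(K_S)$, then $M_G$ is an isometry. -/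

import Mathlib

open scoped ComplexConjugate InnerProductSpace
open scoped Complex.UnitDisc

noncomputable section

namespace AIP

/-! ### Schur class and de Branges–Rovnyak kernels -/

section Schur

variable {U Y : Type*}
  [NormedAddCommGroup U] [InnerProductSpace ℂ U] [CompleteSpace U]
  [NormedAddCommGroup Y] [InnerProductSpace ℂ Y] [CompleteSpace Y]

variable (U Y) in
/-- The Schur class: analytic functions on the open unit disk `𝔻` whose values are contractions
from `U` to `Y`. -/
def schurClass : Set (𝔻 → U →L[ℂ] Y) :=
  {S | (∃ f : ℂ → U →L[ℂ] Y, DifferentiableOn ℂ f (Metric.ball 0 1) ∧ ∀ z : 𝔻, f z = S z) ∧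
    ∀ z, ‖S z‖ ≤ 1}

/-- The de Branges–Rovnyak kernel
`K_S(z, ζ) = (I - S(z) S(ζ)^*) / (1 - z * conj ζ)`, with values in the bounded operators on `Y`.
When it is positive, `RKHS.OfKernel (dbrKernel S)` is the de Branges–Rovnyak space
`H(K_S)`, a Hilbert space of functions `𝔻 → Y`. -/
def dbrKernel (S : 𝔻 → U →L[ℂ] Y) : Matrix 𝔻 𝔻 (Y →L[ℂ] Y) :=
  Matrix.of fun z ζ =>
    (1 - (z : ℂ) * conj (ζ : ℂ))⁻¹ •
      (ContinuousLinearMap.id ℂ Y - S z ∘L ContinuousLinearMap.adjoint (S ζ))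

end Schur

/-! ### Observability operators -/

section Observability

variable {X Z : Type*}
  [NormedAddCommGroup X] [InnerProductSpace ℂ X]
  [NormedAddCommGroup Z] [InnerProductSpace ℂ Z]

/-- `(C, T)` is an analytic output pair: for every `x`, the function `z ↦ C (I - z T)⁻¹ x`, that
is the power series `∑ zⁿ C Tⁿ x`, defines a holomorphic function on the unit disk. -/
def IsAnalyticOutputPair (C : X →L[ℂ] Z) (T : X →L[ℂ] X) : Prop :=
  ∀ x : X, ∀ z : 𝔻, Summable fun n : ℕ => (z : ℂ) ^ n • C ((T ^ n) x)

/-- The observability operator: `observability C T x` is the function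
`z ↦ C (I - z T)⁻¹ x = ∑ zⁿ C Tⁿ x` on the unit disk. -/
def observability (C : X →L[ℂ] Z) (T : X →L[ℂ] X) (x : X) (z : 𝔻) : Z :=
  ∑' n : ℕ, (z : ℂ) ^ n • C ((T ^ n) x)

end Observability

/-- The operators `P, T, E, N` of an abstract interpolation problem for the Schur class. -/
structure Data (X U Y : Type*)
    [NormedAddCommGroup X] [InnerProductSpace ℂ X]
    [NormedAddCommGroup U] [InnerProductSpace ℂ U]
    [NormedAddCommGroup Y] [InnerProductSpace ℂ Y] where
  P : X →L[ℂ] X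
  T : X →L[ℂ] X
  E : X →L[ℂ] Y
  N : X →L[ℂ] U

namespace Data

variable {X U Y : Type*}
  [NormedAddCommGroup X] [InnerProductSpace ℂ X] [CompleteSpace X]
  [NormedAddCommGroup U] [InnerProductSpace ℂ U] [CompleteSpace U]
  [NormedAddCommGroup Y] [InnerProductSpace ℂ Y] [CompleteSpace Y]

/-- Admissibility: `(E, T)` and `(N, T)` are analytic output pairs and `P` is a positive
semidefinite solution of the Stein equation `P - T^* P T = E^* E - N^* N`. -/
structure IsAdmissible (D : Data X U Y) : Prop where
  analytic_E : IsAnalyticOutputPair D.E D.T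
  analytic_N : IsAnalyticOutputPair D.N D.T
  isPositive : D.P.IsPositive
  stein : D.P - ContinuousLinearMap.adjoint D.T ∘L D.P ∘L D.T =
    ContinuousLinearMap.adjoint D.E ∘L D.E - ContinuousLinearMap.adjoint D.N ∘L D.N

/-- The function `F^S(z) = (E - S(z) N)(I - z T)⁻¹`, applied to `x`. -/
def F (D : Data X U Y) (S : 𝔻 → U →L[ℂ] Y) (z : 𝔻) (x : X) : Y :=
  observability D.E D.T x z - S z (observability D.N D.T x z)

/-- The positive square root of `P`. -/
def sqrtP (D : Data X U Y) : X →L[ℂ] X := CFC.sqrt D.P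

/-- `X₀`, the closure of the range of `P^{1/2}`. -/
def X₀ (D : Data X U Y) : Submodule ℂ X :=
  (LinearMap.range (D.sqrtP : X →ₗ[ℂ] X)).topologicalClosure

instance (D : Data X U Y) : CompleteSpace D.X₀ :=
  inferInstanceAs
    (CompleteSpace (LinearMap.range (D.sqrtP : X →ₗ[ℂ] X)).topologicalClosure)

/-- `P^{1/2}` as an operator from `X` to `X₀`. -/
def toX₀ (D : Data X U Y) : X →L[ℂ] D.X₀ :=
  D.sqrtP.codRestrict D.X₀ fun x =>
    Submodule.le_topologicalClosure _ (LinearMap.mem_range_self (D.sqrtP : X →ₗ[ℂ] X) x)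

/-- The Hilbert space direct sum `X₀ ⊕ U`. -/
abbrev InSpace (D : Data X U Y) : Type _ := WithLp 2 (D.X₀ × U)

/-- The Hilbert space direct sum `X₀ ⊕ Y`. -/
abbrev OutSpace (D : Data X U Y) : Type _ := WithLp 2 (D.X₀ × Y)

/-- The operator `x ↦ (P^{1/2} x, N x)`. -/
def colIn (D : Data X U Y) : X →L[ℂ] D.InSpace :=
  (WithLp.prodContinuousLinearEquiv 2 ℂ D.X₀ U).symm ∘L (D.toX₀.prod D.N)

/-- The operator `x ↦ (P^{1/2} T x, E x)`. -/
def colOut (D : Data X U Y) : X →L[ℂ] D.OutSpace :=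
  (WithLp.prodContinuousLinearEquiv 2 ℂ D.X₀ Y).symm ∘L ((D.toX₀ ∘L D.T).prod D.E)

/-- The domain `𝒟_V` of `V`: the closure of the range of `x ↦ (P^{1/2} x, N x)`. -/
def domV (D : Data X U Y) : Submodule ℂ D.InSpace :=
  (LinearMap.range (D.colIn : X →ₗ[ℂ] D.InSpace)).topologicalClosure

/-- The range `ℛ_V` of `V`: the closure of the range of `x ↦ (P^{1/2} T x, E x)`. -/
def ranV (D : Data X U Y) : Submodule ℂ D.OutSpace :=
  (LinearMap.range (D.colOut : X →ₗ[ℂ] D.OutSpace)).topologicalClosure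

instance (D : Data X U Y) : CompleteSpace D.domV :=
  inferInstanceAs
    (CompleteSpace (LinearMap.range (D.colIn : X →ₗ[ℂ] D.InSpace)).topologicalClosure)

/-- `x ↦ (P^{1/2} x, N x)` as an operator into `𝒟_V`. -/
def toDomV (D : Data X U Y) : X →L[ℂ] D.domV :=
  D.colIn.codRestrict D.domV fun x =>
    Submodule.le_topologicalClosure _ (LinearMap.mem_range_self (D.colIn : X →ₗ[ℂ] D.InSpace) x)

/-- The isometry `V : 𝒟_V → X₀ ⊕ Y`, with range `ℛ_V`: the extension by continuity of
`(P^{1/2} x, N x) ↦ (P^{1/2} T x, E x)`. -/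
def V (D : Data X U Y) : D.domV →L[ℂ] D.OutSpace :=
  (D.colOut : X →ₗ[ℂ] D.OutSpace).extendOfNorm (D.toDomV : X →ₗ[ℂ] D.domV)

/-- The defect space `Δ = (X₀ ⊕ U) ⊖ 𝒟_V`. -/
def Delta (D : Data X U Y) : Submodule ℂ D.InSpace := D.domVᗮ

/-- The defect space `Δ_* = (X₀ ⊕ Y) ⊖ ℛ_V`. -/
def DeltaStar (D : Data X U Y) : Submodule ℂ D.OutSpace := D.ranVᗮ

instance (D : Data X U Y) : CompleteSpace D.Delta :=
  inferInstanceAs (CompleteSpace D.domVᗮ)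

/-! ### The unitary colligation -/

section Colligation

variable {Δt Δst : Type*}
  [NormedAddCommGroup Δt] [InnerProductSpace ℂ Δt] [CompleteSpace Δt]
  [NormedAddCommGroup Δst] [InnerProductSpace ℂ Δst] [CompleteSpace Δst]

/-- The unitary colligation
`𝐔 : (X₀ ⊕ U) ⊕ Δ̃_* → (X₀ ⊕ Y) ⊕ Δ̃` associated with the identification maps `i : Δ → Δ̃` and
`i_* : Δ_* → Δ̃_*`. It is `V` on `𝒟_V`, it is `i` on `Δ`, and it is `i_*^*` on `Δ̃_*`:
`𝐔 (w, d) = (V (P_{𝒟_V} w) + i_*^* d, i (P_Δ w))`. -/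
def colligation (D : Data X U Y) (i : D.Delta ≃ₗᵢ[ℂ] Δt) (iStar : D.DeltaStar ≃ₗᵢ[ℂ] Δst) :
    WithLp 2 (D.InSpace × Δst) →L[ℂ] WithLp 2 (D.OutSpace × Δt) :=
  (WithLp.prodContinuousLinearEquiv 2 ℂ D.OutSpace Δt).symm ∘L
    ((D.V ∘L D.domV.orthogonalProjectionOnto ∘L WithLp.fstL 2 ℂ D.InSpace Δst +
        D.DeltaStar.subtypeL ∘L (iStar.symm : Δst →L[ℂ] D.DeltaStar) ∘L
          WithLp.sndL 2 ℂ D.InSpace Δst).prod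
      ((i : D.Delta →L[ℂ] Δt) ∘L D.Delta.orthogonalProjectionOnto ∘L WithLp.fstL 2 ℂ D.InSpace Δst))

variable (Δst) in
/-- The inclusion of `X₀` in `(X₀ ⊕ U) ⊕ Δ̃_*`. -/
def inX (D : Data X U Y) : D.X₀ →L[ℂ] WithLp 2 (D.InSpace × Δst) :=
  (WithLp.prodContinuousLinearEquiv 2 ℂ D.InSpace Δst).symm ∘L
    ContinuousLinearMap.inl ℂ D.InSpace Δst ∘L
    (WithLp.prodContinuousLinearEquiv 2 ℂ D.X₀ U).symm ∘L ContinuousLinearMap.inl ℂ D.X₀ U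

variable (Δst) in
/-- The inclusion of `U` in `(X₀ ⊕ U) ⊕ Δ̃_*`. -/
def inU (D : Data X U Y) : U →L[ℂ] WithLp 2 (D.InSpace × Δst) :=
  (WithLp.prodContinuousLinearEquiv 2 ℂ D.InSpace Δst).symm ∘L
    ContinuousLinearMap.inl ℂ D.InSpace Δst ∘L
    (WithLp.prodContinuousLinearEquiv 2 ℂ D.X₀ U).symm ∘L ContinuousLinearMap.inr ℂ D.X₀ U

variable (Δst) in
/-- The inclusion of `Δ̃_*` in `(X₀ ⊕ U) ⊕ Δ̃_*`. -/
def inΔ (D : Data X U Y) : Δst →L[ℂ] WithLp 2 (D.InSpace × Δst) :=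
  (WithLp.prodContinuousLinearEquiv 2 ℂ D.InSpace Δst).symm ∘L
    ContinuousLinearMap.inr ℂ D.InSpace Δst

variable (Δt) in
/-- The projection of `(X₀ ⊕ Y) ⊕ Δ̃` on `X₀`. -/
def outX (D : Data X U Y) : WithLp 2 (D.OutSpace × Δt) →L[ℂ] D.X₀ :=
  WithLp.fstL 2 ℂ D.X₀ Y ∘L WithLp.fstL 2 ℂ D.OutSpace Δt

variable (Δt) in
/-- The projection of `(X₀ ⊕ Y) ⊕ Δ̃` on `Y`. -/
def outY (D : Data X U Y) : WithLp 2 (D.OutSpace × Δt) →L[ℂ] Y :=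
  WithLp.sndL 2 ℂ D.X₀ Y ∘L WithLp.fstL 2 ℂ D.OutSpace Δt

variable (Δt) in
/-- The projection of `(X₀ ⊕ Y) ⊕ Δ̃` on `Δ̃`. -/
def outΔ (D : Data X U Y) : WithLp 2 (D.OutSpace × Δt) →L[ℂ] Δt :=
  WithLp.sndL 2 ℂ D.OutSpace Δt

variable (D : Data X U Y) (i : D.Delta ≃ₗᵢ[ℂ] Δt) (iStar : D.DeltaStar ≃ₗᵢ[ℂ] Δst)

/-- The block `A : X₀ → X₀` of the colligation. -/
def A : D.X₀ →L[ℂ] D.X₀ := D.outX Δt ∘L D.colligation i iStar ∘L D.inX Δst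

/-- The block `B₁ : U → X₀` of the colligation. -/
def B₁ : U →L[ℂ] D.X₀ := D.outX Δt ∘L D.colligation i iStar ∘L D.inU Δst

/-- The block `B₂ : Δ̃_* → X₀` of the colligation. -/
def B₂ : Δst →L[ℂ] D.X₀ := D.outX Δt ∘L D.colligation i iStar ∘L D.inΔ Δst

/-- The block `C₁ : X₀ → Y` of the colligation. -/
def C₁ : D.X₀ →L[ℂ] Y := D.outY Δt ∘L D.colligation i iStar ∘L D.inX Δst

/-- The block `D₁₁ : U → Y` of the colligation. -/
def D₁₁ : U →L[ℂ] Y := D.outY Δt ∘L D.colligation i iStar ∘L D.inU Δst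

/-- The block `D₁₂ : Δ̃_* → Y` of the colligation. -/
def D₁₂ : Δst →L[ℂ] Y := D.outY Δt ∘L D.colligation i iStar ∘L D.inΔ Δst

/-- The block `C₂ : X₀ → Δ̃` of the colligation. -/
def C₂ : D.X₀ →L[ℂ] Δt := D.outΔ Δt ∘L D.colligation i iStar ∘L D.inX Δst

/-- The block `D₂₁ : U → Δ̃` of the colligation. -/
def D₂₁ : U →L[ℂ] Δt := D.outΔ Δt ∘L D.colligation i iStar ∘L D.inU Δst

/-- The block `D₂₂ : Δ̃_* → Δ̃` of the colligation (it is zero). -/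
def D₂₂ : Δst →L[ℂ] Δt := D.outΔ Δt ∘L D.colligation i iStar ∘L D.inΔ Δst

/-! ### The characteristic function and its Redheffer transform -/

/-- The resolvent `(I - z A)⁻¹`. -/
def resolventA (z : 𝔻) : D.X₀ →L[ℂ] D.X₀ := Ring.inverse (1 - (z : ℂ) • D.A i iStar)

/-- The entry `Σ₁₁(z) = D₁₁ + z C₁ (I - z A)⁻¹ B₁` of the characteristic function. -/
def Sigma₁₁ (z : 𝔻) : U →L[ℂ] Y :=
  D.D₁₁ i iStar + (z : ℂ) • (D.C₁ i iStar ∘L D.resolventA i iStar z ∘L D.B₁ i iStar)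

/-- The entry `Σ₁₂(z) = D₁₂ + z C₁ (I - z A)⁻¹ B₂` of the characteristic function. -/
def Sigma₁₂ (z : 𝔻) : Δst →L[ℂ] Y :=
  D.D₁₂ i iStar + (z : ℂ) • (D.C₁ i iStar ∘L D.resolventA i iStar z ∘L D.B₂ i iStar)

/-- The entry `Σ₂₁(z) = D₂₁ + z C₂ (I - z A)⁻¹ B₁` of the characteristic function. -/
def Sigma₂₁ (z : 𝔻) : U →L[ℂ] Δt :=
  D.D₂₁ i iStar + (z : ℂ) • (D.C₂ i iStar ∘L D.resolventA i iStar z ∘L D.B₁ i iStar)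

/-- The entry `Σ₂₂(z) = D₂₂ + z C₂ (I - z A)⁻¹ B₂` of the characteristic function. -/
def Sigma₂₂ (z : 𝔻) : Δst →L[ℂ] Δt :=
  D.D₂₂ i iStar + (z : ℂ) • (D.C₂ i iStar ∘L D.resolventA i iStar z ∘L D.B₂ i iStar)

/-- The function `G(z) = Σ₁₂(z) (I - ℰ(z) Σ₂₂(z))⁻¹`. -/
def G (ℰ : 𝔻 → Δt →L[ℂ] Δst) (z : 𝔻) : Δst →L[ℂ] Y :=
  D.Sigma₁₂ i iStar z ∘L Ring.inverse (1 - ℰ z ∘L D.Sigma₂₂ i iStar z)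

/-- The Redheffer transform `ℛ_Σ[ℰ] = Σ₁₁ + Σ₁₂ (I - ℰ Σ₂₂)⁻¹ ℰ Σ₂₁`. -/
def redheffer (ℰ : 𝔻 → Δt →L[ℂ] Δst) (z : 𝔻) : U →L[ℂ] Y :=
  D.Sigma₁₁ i iStar z +
    D.Sigma₁₂ i iStar z ∘L Ring.inverse (1 - ℰ z ∘L D.Sigma₂₂ i iStar z) ∘L ℰ z ∘L
      D.Sigma₂₁ i iStar z

end Colligation

end Data

end AIP

end

noncomputable section

namespace AIP

open ContinuousLinearMap Filter Topology Metric

set_option linter.unusedSectionVars false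

/-! The Stein equation says exactly that `(P^{1/2} x, N x) ↦ (P^{1/2} T x, E x)` preserves norms. It
therefore extends to the isometry `V`, and filling in the two defect spaces gives a unitary `𝐔`.
Closing the loop of this system with a Schur function `ℰ` gives `S = ℛ_Σ[ℰ]`. Put `Γ(z) = (C₁ + G ℰ
C₂)(I - zA)⁻¹`; then everything follows from the row identity `[zΓ, I, Gℰ] 𝐔 = [Γ, S, G]`.

Multiplying the identity at `z` by its adjoint at `ζ` and cancelling `𝐔𝐔^* = I` gives `K_S = G K_ℰ
G^* + Γ Γ^*` (`dbrKernel_redheffer`). On the level of spaces, `[M_G, M_Γ]` is a coisometry from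
`H(K_ℰ) ⊕ X₀` onto `H(K_S)` (`exists_multiplication_operators`). Contractivity of `S` is read off
from the same cancellation on the diagonal. Applying the row identity to `(P^{1/2} x, N x, 0)` and
iterating gives `Γ P^{1/2} = F^S`, so that `M_{F^S} = M_Γ P^{1/2}` is bounded.

Injectivity is decided at `z = 0`. There `Σ₂₂` vanishes, `G(0) = D₁₂` is injective because `T^*` is,
and `Σ₂₁(0) = D₂₁` always has dense range. Holomorphic factors with these properties at a single
point can be cancelled on the whole disk (`HoloDisk.eq_zero_of_bilin_eq_zero`). This yields both the
injectivity of `ℛ_Σ` and the triviality of `ker M_G`; the latter needs the elements of `H(K_ℰ)` to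
be holomorphic. If `P = M_{F^S}^* M_{F^S}`, then `M_Γ` is isometric, and a coisometric row with one
isometric and one injective entry has the other entry isometric too (`isometry_of_coisometry`). -/

/-! ### Holomorphic functions on the unit disk -/

/-- A function on the unit disk is holomorphic if it is the restriction of a function on `ℂ` that
is differentiable on the unit ball. -/
def HoloDisk {E : Type*} [NormedAddCommGroup E] [NormedSpace ℂ E] (φ : 𝔻 → E) : Prop :=
  ∃ f : ℂ → E, DifferentiableOn ℂ f (ball 0 1) ∧ ∀ z : 𝔻, f z = φ z

namespace HoloDisk

variable {E F G : Type*} [NormedAddCommGroup E] [NormedSpace ℂ E]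
  [NormedAddCommGroup F] [NormedSpace ℂ F] [NormedAddCommGroup G] [NormedSpace ℂ G]

lemma const (c : E) : HoloDisk fun _ : 𝔻 => c :=
  ⟨fun _ => c, differentiableOn_const c, fun _ => rfl⟩

lemma coe : HoloDisk fun z : 𝔻 => (z : ℂ) :=
  ⟨id, differentiableOn_id, fun _ => rfl⟩

lemma add {φ ψ : 𝔻 → E} (hφ : HoloDisk φ) (hψ : HoloDisk ψ) : HoloDisk fun z => φ z + ψ z := by
  obtain ⟨f, hf, hf'⟩ := hφ
  obtain ⟨g, hg, hg'⟩ := hψ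
  exact ⟨fun z => f z + g z, hf.add hg, fun z => by simp only [hf', hg']⟩

lemma sub {φ ψ : 𝔻 → E} (hφ : HoloDisk φ) (hψ : HoloDisk ψ) : HoloDisk fun z => φ z - ψ z := by
  obtain ⟨f, hf, hf'⟩ := hφ
  obtain ⟨g, hg, hg'⟩ := hψ
  exact ⟨fun z => f z - g z, hf.sub hg, fun z => by simp only [hf', hg']⟩

lemma smul {c : 𝔻 → ℂ} {φ : 𝔻 → E} (hc : HoloDisk c) (hφ : HoloDisk φ) :
    HoloDisk fun z => c z • φ z := by
  obtain ⟨f, hf, hf'⟩ := hc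
  obtain ⟨g, hg, hg'⟩ := hφ
  exact ⟨fun z => f z • g z, hf.smul hg, fun z => by simp only [hf', hg']⟩

lemma clm_comp {φ : 𝔻 → F →L[ℂ] G} {ψ : 𝔻 → E →L[ℂ] F} (hφ : HoloDisk φ) (hψ : HoloDisk ψ) :
    HoloDisk fun z => φ z ∘L ψ z := by
  obtain ⟨f, hf, hf'⟩ := hφ
  obtain ⟨g, hg, hg'⟩ := hψ
  exact ⟨fun z => f z ∘L g z, hf.clm_comp hg, fun z => by simp only [hf', hg']⟩

lemma clm_apply {φ : 𝔻 → F →L[ℂ] G} {ψ : 𝔻 → F} (hφ : HoloDisk φ) (hψ : HoloDisk ψ) :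
    HoloDisk fun z => φ z (ψ z) := by
  obtain ⟨f, hf, hf'⟩ := hφ
  obtain ⟨g, hg, hg'⟩ := hψ
  exact ⟨fun z => f z (g z), hf.clm_apply hg, fun z => by simp only [hf', hg']⟩

lemma ringInverse {R : Type*} [NormedRing R] [NormedAlgebra ℂ R] [HasSummableGeomSeries R]
    {φ : 𝔻 → R} (hφ : HoloDisk φ) (h : ∀ z, IsUnit (φ z)) :
    HoloDisk fun z => Ring.inverse (φ z) := by
  obtain ⟨f, hf, hf'⟩ := hφ
  refine ⟨fun z => Ring.inverse (f z), fun z hz => ?_, fun z => by simp only [hf']⟩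
  obtain ⟨u, hu⟩ := h (.mk z (by simpa using hz))
  have hfu : f z = u := by rw [hu, ← hf', Complex.UnitDisc.coe_mk]
  have := differentiableAt_inverse (𝕜 := ℂ) u.isUnit
  rw [← hfu] at this
  exact this.comp_differentiableWithinAt z (hf z hz)

/-- If `B (φ z) (ψ z) = 0` on the disk and `B (φ 0)` is injective, then `ψ = 0`. -/
lemma eq_zero_of_bilin_eq_zero [CompleteSpace F] (B : E →L[ℂ] F →L[ℂ] G) {φ : 𝔻 → E} {ψ : 𝔻 → F}
    (hφ : HoloDisk φ) (hψ : HoloDisk ψ) (hB : ∀ v, B (φ 0) v = 0 → v = 0)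
    (h : ∀ z, B (φ z) (ψ z) = 0) (z : 𝔻) : ψ z = 0 := by
  obtain ⟨f, hf, hf'⟩ := hφ
  obtain ⟨g, hg, hg'⟩ := hψ
  have hball : ball (0 : ℂ) 1 ∈ 𝓝 (0 : ℂ) := ball_mem_nhds _ one_pos
  have hg_an : AnalyticOnNhd ℂ g (ball 0 1) := hg.analyticOnNhd isOpen_ball
  have hfc : ContinuousAt f 0 := (hf.differentiableAt hball).continuousAt
  have hfg : ∀ w ∈ ball (0 : ℂ) 1, B (f w) (g w) = 0 := fun w hw => by
    have := h (.mk w (by simpa using hw))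
    rwa [← hf', ← hg', Complex.UnitDisc.coe_mk] at this
  -- Otherwise `g w = w ^ n • k w` near `0` with `k 0 ≠ 0`. Dividing by `w ^ n` and letting `w → 0`
  -- gives `B (f 0) (k 0) = 0`, against the injectivity at `0`.
  have key : ∀ᶠ w in 𝓝 (0 : ℂ), g w = 0 := by
    by_contra hne
    obtain ⟨n, k, hk, hk0, hgk⟩ :=
      (hg_an 0 (mem_ball_self one_pos)).exists_eventuallyEq_pow_smul_nonzero_iff.2 hne
    refine hk0 (hB _ ?_)
    rw [← hf', Complex.UnitDisc.coe_zero]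
    have hcont : ContinuousAt (fun w => B (f w) (k w)) 0 :=
      (B.continuous.continuousAt.comp hfc).clm_apply hk.continuousAt
    have hz : ∀ᶠ w in 𝓝[≠] (0 : ℂ), B (f w) (k w) = 0 := by
      filter_upwards [nhdsWithin_le_nhds hgk, nhdsWithin_le_nhds hball, self_mem_nhdsWithin]
        with w hw hwb hw0
      have := hfg w hwb
      rw [hw, map_smul] at this
      refine (smul_eq_zero.1 this).resolve_left (pow_ne_zero _ ?_)
      simpa using hw0
    exact tendsto_nhds_unique (hcont.tendsto.mono_left nhdsWithin_le_nhds)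
      (tendsto_const_nhds.congr' (hz.mono fun w hw => hw.symm))
  rw [← hg']
  exact hg_an.eqOn_zero_of_preconnected_of_eventuallyEq_zero (convex_ball _ _).isPreconnected
    (mem_ball_self one_pos) key (by simpa using z.norm_lt_one)

end HoloDisk

/-! ### Positivity of the de Branges–Rovnyak kernel -/

section Positivity

open Real (circleAverage)

variable {U Y : Type*}
  [NormedAddCommGroup U] [InnerProductSpace ℂ U] [CompleteSpace U]
  [NormedAddCommGroup Y] [InnerProductSpace ℂ Y] [CompleteSpace Y]

lemma one_sub_conj_mul_ne_zero {x w : ℂ} (hx : ‖x‖ < 1) (hw : ‖w‖ ≤ 1) : 1 - conj x * w ≠ 0 := by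
  intro h
  have : ‖conj x * w‖ = 1 := by rw [← sub_eq_zero.1 h, norm_one]
  rw [norm_mul, RCLike.norm_conj] at this
  nlinarith [norm_nonneg x, norm_nonneg w]

omit [CompleteSpace Y] in
/-- The Szegő kernel reproduces the values of holomorphic functions. -/
lemma circleAverage_inner_szego {x : ℂ} (hx : ‖x‖ < 1) (v : Y) {h : ℂ → Y}
    (hh : DifferentiableOn ℂ h (closedBall 0 1)) :
    circleAverage (fun w => ⟪(1 - conj x * w)⁻¹ • v, h w⟫_ℂ) 0 1 = ⟪v, h x⟫_ℂ := by
  have h1 : DiffContOnCl ℂ (fun w => ⟪v, h w⟫_ℂ) (ball 0 |1|) := by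
    rw [abs_one]
    refine (innerSL ℂ v).differentiable.comp_diffContOnCl (DifferentiableOn.diffContOnCl ?_)
    rwa [closure_ball _ one_ne_zero]
  -- On the unit circle `conj w = w⁻¹`, so the conjugated Szegő factor is `w / (w - x)`, the weight
  -- in the averaged form of Cauchy's formula.
  rw [← h1.circleAverage_smul_div (w := x) (by simpa using hx)]
  refine Real.circleAverage_congr_sphere fun w hw => ?_
  have hw1 : ‖w‖ = 1 := by simpa using hw
  have hw0 : w ≠ 0 := by rintro rfl; simp at hw1
  have hc : conj w = w⁻¹ := by rw [Complex.inv_def, Complex.normSq_eq_norm_sq, hw1]; simp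
  have hwx : w - x ≠ 0 := by
    intro h; rw [sub_eq_zero.1 h] at hw1; linarith
  simp only [inner_smul_left, smul_eq_mul, sub_zero, map_inv₀, map_sub, map_one, map_mul,
    Complex.conj_conj, hc]
  congr 1
  field_simp

/-- The finite combination `∑ (1 - conj x * w)⁻¹ • v x` of Szegő kernel functions. -/
def szegoSum (s : Finset 𝔻) (v : 𝔻 → Y) (w : ℂ) : Y :=
  ∑ x ∈ s, (1 - conj (x : ℂ) * w)⁻¹ • v x

omit [CompleteSpace Y] in
lemma differentiableOn_szego (x : 𝔻) (v : Y) :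
    DifferentiableOn ℂ (fun w : ℂ => (1 - conj (x : ℂ) * w)⁻¹ • v) (closedBall 0 1) := by
  intro w hw
  have := one_sub_conj_mul_ne_zero x.norm_lt_one (by simpa using hw)
  exact DifferentiableAt.differentiableWithinAt (by fun_prop (disch := exact this))

omit [CompleteSpace Y] in
lemma differentiableOn_szegoSum (s : Finset 𝔻) (v : 𝔻 → Y) :
    DifferentiableOn ℂ (szegoSum s v) (closedBall 0 1) :=
  DifferentiableOn.fun_sum fun x _ => differentiableOn_szego x (v x)

omit [CompleteSpace Y] in
lemma circleIntegrable_inner {f h : ℂ → Y} (hf : DifferentiableOn ℂ f (closedBall 0 1))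
    (hh : DifferentiableOn ℂ h (closedBall 0 1)) :
    CircleIntegrable (fun w => ⟪f w, h w⟫_ℂ) 0 1 :=
  ((hf.continuousOn.inner hh.continuousOn).mono sphere_subset_closedBall).circleIntegrable
    zero_le_one

omit [CompleteSpace Y] in
lemma circleAverage_inner_szegoSum (s : Finset 𝔻) (v : 𝔻 → Y) {h : ℂ → Y}
    (hh : DifferentiableOn ℂ h (closedBall 0 1)) :
    circleAverage (fun w => ⟪szegoSum s v w, h w⟫_ℂ) 0 1 = ∑ x ∈ s, ⟪v x, h x⟫_ℂ := by
  simp only [szegoSum, sum_inner]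
  rw [Real.circleAverage_fun_sum fun x _ => circleIntegrable_inner (differentiableOn_szego x _) hh]
  exact Finset.sum_congr rfl fun x _ => circleAverage_inner_szego x.norm_lt_one _ hh

/-- Let `f` and `g` be the Szegő sums of `v` and of `u x = S(x)^* v x`. By the reproducing property
the average of `⟪f, S g⟫` equals that of `⟪g, g⟫`, so the double sum is the average of `⟪f, f⟫ -
2⟪f, S g⟫ + ⟪g, g⟫`. Its real part is at least `‖f - S g‖²`, as `S` is contractive. -/
lemma szego_sum_nonneg {S : ℂ → U →L[ℂ] Y} (hS : DifferentiableOn ℂ S (closedBall 0 1))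
    (hS1 : ∀ w ∈ closedBall (0 : ℂ) 1, ‖S w‖ ≤ 1) (s : Finset 𝔻) (v : 𝔻 → Y) :
    0 ≤ Complex.re (∑ x ∈ s, ∑ x' ∈ s, (1 - conj (x' : ℂ) * x)⁻¹ *
      (⟪v x, v x'⟫_ℂ - ⟪adjoint (S x) (v x), adjoint (S x') (v x')⟫_ℂ)) := by
  set u : 𝔻 → U := fun x => adjoint (S x) (v x) with hu
  have hfd := differentiableOn_szegoSum s v
  have hgd := differentiableOn_szegoSum s u
  have hSg : DifferentiableOn ℂ (fun w => S w (szegoSum s u w)) (closedBall 0 1) :=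
    hS.clm_apply hgd
  have iff_ := circleIntegrable_inner hfd hfd
  have igg := circleIntegrable_inner hgd hgd
  have ifg := circleIntegrable_inner hfd hSg
  have key : circleAverage (fun w => ⟪szegoSum s v w, szegoSum s v w⟫_ℂ
        - ⟪szegoSum s v w, S w (szegoSum s u w)⟫_ℂ - ⟪szegoSum s v w, S w (szegoSum s u w)⟫_ℂ
        + ⟪szegoSum s u w, szegoSum s u w⟫_ℂ) 0 1 =
      ∑ x ∈ s, ∑ x' ∈ s, (1 - conj (x' : ℂ) * x)⁻¹ * (⟪v x, v x'⟫_ℂ - ⟪u x, u x'⟫_ℂ) := by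
    refine (Real.circleAverage_add ((iff_.sub ifg).sub ifg) igg).trans ?_
    rw [Real.circleAverage_sub (iff_.sub ifg) ifg, Real.circleAverage_sub iff_ ifg,
      circleAverage_inner_szegoSum s v hfd, circleAverage_inner_szegoSum s v hSg,
      circleAverage_inner_szegoSum s u hgd]
    simp only [← adjoint_inner_left, hu, szegoSum, inner_sum, inner_smul_right, mul_sub,
      Finset.sum_sub_distrib]
    ring
  rw [← key]
  have hre := Complex.reCLM.circleAverage_comp_comm (((iff_.sub ifg).sub ifg).add igg)
  refine le_of_le_of_eq (Real.circleAverage_nonneg_of_nonneg fun w hw => ?_) hre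
  have hw' : w ∈ closedBall (0 : ℂ) 1 := sphere_subset_closedBall (by simpa using hw)
  set a := szegoSum s v w
  set b := szegoSum s u w
  have h1 : ‖S w b‖ ≤ ‖b‖ := (le_opNorm _ _).trans
    (mul_le_of_le_one_left (norm_nonneg _) (hS1 w hw'))
  have h2 := norm_sub_sq (𝕜 := ℂ) a (S w b)
  have h3 : (⟪a, a⟫_ℂ).re = ‖a‖ ^ 2 := inner_self_eq_norm_sq (𝕜 := ℂ) a
  have h4 : (⟪b, b⟫_ℂ).re = ‖b‖ ^ 2 := inner_self_eq_norm_sq (𝕜 := ℂ) b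
  have h5 : RCLike.re ⟪a, S w b⟫_ℂ = (⟪a, S w b⟫_ℂ).re := rfl
  change 0 ≤ (⟪a, a⟫_ℂ - ⟪a, S w b⟫_ℂ - ⟪a, S w b⟫_ℂ + ⟪b, b⟫_ℂ).re
  simp only [Complex.add_re, Complex.sub_re, h3, h4]
  rw [h5] at h2
  nlinarith [sq_nonneg ‖a - S w b‖, norm_nonneg (S w b), norm_nonneg b]

/-- The de Branges–Rovnyak kernel of a Schur function is positive. -/
theorem dbrKernel_posSemidef {S : 𝔻 → U →L[ℂ] Y} (hS : S ∈ schurClass U Y) :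
    (dbrKernel S).PosSemidef := by
  obtain ⟨⟨f, hf, hf'⟩, hS1⟩ := hS
  have tfae := (RKHS.posSemidef_tfae (K := dbrKernel S)).out 0 2
  refine tfae.2 ⟨?_, fun v => ?_⟩
  · ext z ζ : 2
    simp only [Matrix.conjTranspose_apply, dbrKernel, Matrix.of_apply, star_eq_adjoint]
    rw [map_smulₛₗ, map_sub, adjoint_comp, adjoint_adjoint, adjoint_id]
    simp [mul_comm]
  -- A Schur function need not extend to the circle, but its dilations `z ↦ f (r z)` with `r < 1`
  -- do. The Szegő factors are left undilated, and `r` tends to `1` from below.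
  · set q : ℝ → ℝ := fun r => Complex.re (∑ x ∈ v.support, ∑ x' ∈ v.support,
      (1 - conj (x' : ℂ) * x)⁻¹ * (⟪v x, v x'⟫_ℂ -
        ⟪adjoint (f (r * x)) (v x), adjoint (f (r * x')) (v x')⟫_ℂ)) with hq
    have hq0 : ∀ᶠ r in 𝓝[<] (1 : ℝ), 0 ≤ q r := by
      filter_upwards [Ioo_mem_nhdsLT (zero_lt_one' ℝ)] with r hr
      have hmaps : ∀ w ∈ closedBall (0 : ℂ) 1, (r : ℂ) * w ∈ ball (0 : ℂ) 1 := fun w hw => by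
        have : ‖w‖ ≤ 1 := by simpa using hw
        rw [mem_ball_zero_iff, norm_mul, Complex.norm_real, Real.norm_eq_abs, abs_of_pos hr.1]
        nlinarith [hr.1, hr.2, norm_nonneg w]
      refine szego_sum_nonneg (S := fun w => f (r * w)) ?_ ?_ v.support v
      · exact hf.comp (differentiableOn_id.const_mul _) hmaps
      · intro w hw
        have := hS1 (.mk (r * w) (by simpa using hmaps w hw))
        rwa [← hf', Complex.UnitDisc.coe_mk] at this
    have hc : ∀ x : 𝔻, ContinuousAt (fun r : ℝ => adjoint (f (r * x)) (v x)) 1 := fun x => by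
      have h1 : ContinuousAt f ((1 : ℝ) * x) := by
        refine (hf.differentiableAt (isOpen_ball.mem_nhds ?_)).continuousAt
        simpa using x.norm_lt_one
      have h2 : ContinuousAt (fun r : ℝ => (r : ℂ) * x) 1 := by fun_prop
      exact ((adjoint (𝕜 := ℂ)).continuous.continuousAt.comp
        (ContinuousAt.comp (f := fun r : ℝ => (r : ℂ) * x) h1 h2)).clm_apply continuousAt_const
    have hqc : ContinuousAt q 1 := by
      refine Complex.continuous_re.continuousAt.comp ?_
      refine tendsto_finsetSum _ fun x _ => tendsto_finsetSum _ fun x' _ => ?_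
      exact continuousAt_const.mul (continuousAt_const.sub ((hc x).inner (hc x')))
    have h1 : 0 ≤ q 1 := ge_of_tendsto (hqc.tendsto.mono_left nhdsWithin_le_nhds) hq0
    refine h1.trans_eq ?_
    simp only [hq, Finsupp.sum, dbrKernel, Matrix.of_apply, Complex.ofReal_one, one_mul, hf']
    change _ = Complex.re _
    congr 1
    refine Finset.sum_congr rfl fun x _ => Finset.sum_congr rfl fun x' _ => ?_
    simp only [smul_apply, inner_smul_left, sub_apply, comp_apply, id_apply, inner_sub_left,
      adjoint_inner_right]
    simp

end Positivity

/-! ### Operators between reproducing kernel Hilbert spaces -/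

section Kernel

/-- Two families of operators with the same Gram operators are intertwined by an isometry,
provided that the ranges of the first one span a dense subspace. -/
lemma exists_isometry_of_gram_eq {Ω Y H K : Type*}
    [NormedAddCommGroup Y] [InnerProductSpace ℂ Y]
    [NormedAddCommGroup H] [InnerProductSpace ℂ H]
    [NormedAddCommGroup K] [InnerProductSpace ℂ K] [CompleteSpace K]
    (a : Ω → Y →L[ℂ] H) (b : Ω → Y →L[ℂ] K)
    (hab : ∀ z ζ y y', ⟪b z y, b ζ y'⟫_ℂ = ⟪a z y, a ζ y'⟫_ℂ)
    (ha : (Submodule.span ℂ {x | ∃ z y, a z y = x}).topologicalClosure = ⊤) :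
    ∃ W : H →L[ℂ] K, (∀ z y, W (a z y) = b z y) ∧ ∀ h, ‖W h‖ = ‖h‖ := by
  classical
  set e : (Ω →₀ Y) →ₗ[ℂ] H := Finsupp.lsum ℂ fun z => (a z : Y →ₗ[ℂ] H) with he
  set f : (Ω →₀ Y) →ₗ[ℂ] K := Finsupp.lsum ℂ fun z => (b z : Y →ₗ[ℂ] K) with hf
  have e1 : ∀ z y, e (Finsupp.single z y) = a z y := fun z y => by simp [he]
  have f1 : ∀ z y, f (Finsupp.single z y) = b z y := fun z y => by simp [hf]
  have hd : DenseRange e := by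
    have hle : Submodule.span ℂ {x | ∃ z y, a z y = x} ≤ LinearMap.range e := by
      rw [Submodule.span_le]
      rintro _ ⟨z, y, rfl⟩
      exact ⟨_, e1 z y⟩
    exact (Submodule.dense_iff_topologicalClosure_eq_top.2 ha).mono hle
  have hn : ∀ v, ‖f v‖ = ‖e v‖ := fun v => by
    have : ⟪f v, f v⟫_ℂ = ⟪e v, e v⟫_ℂ := by
      simp only [he, hf, Finsupp.lsum_apply, Finsupp.sum, sum_inner, inner_sum, coe_coe, hab]
    rw [inner_self_eq_norm_sq_to_K, inner_self_eq_norm_sq_to_K] at this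
    have h2 : ‖f v‖ ^ 2 = ‖e v‖ ^ 2 := by exact_mod_cast this
    exact (sq_eq_sq₀ (norm_nonneg _) (norm_nonneg _)).1 h2
  have hW : ∀ v, f.extendOfNorm e (e v) = f v :=
    LinearMap.extendOfNorm_eq hd ⟨1, fun v => by rw [hn, one_mul]⟩
  refine ⟨f.extendOfNorm e, fun z y => by rw [← e1, hW, f1], fun h => ?_⟩
  refine hd.induction (P := fun h => ‖f.extendOfNorm e h‖ = ‖h‖) ?_
    (isClosed_eq (by fun_prop) (by fun_prop)) h
  rintro _ ⟨v, rfl⟩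
  rw [hW, hn]

variable {Ω E Y X H₁ H₂ : Type*}
  [NormedAddCommGroup E] [InnerProductSpace ℂ E] [CompleteSpace E]
  [NormedAddCommGroup Y] [InnerProductSpace ℂ Y] [CompleteSpace Y]
  [NormedAddCommGroup X] [InnerProductSpace ℂ X] [CompleteSpace X]
  [NormedAddCommGroup H₁] [InnerProductSpace ℂ H₁] [CompleteSpace H₁] [RKHS ℂ H₁ Ω E]
  [NormedAddCommGroup H₂] [InnerProductSpace ℂ H₂] [CompleteSpace H₂] [RKHS ℂ H₂ Ω Y]

/-- If `K₂ = G K₁ G^* + Γ Γ^*`, then multiplication by `[G, Γ]` is a coisometry from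
`H(K₁) ⊕ X` to `H(K₂)`. -/
theorem exists_multiplication_operators {G : Ω → E →L[ℂ] Y} {Γ : Ω → X →L[ℂ] Y}
    (hK : ∀ z ζ, RKHS.kernel H₂ z ζ =
      G z ∘L RKHS.kernel H₁ z ζ ∘L adjoint (G ζ) + Γ z ∘L adjoint (Γ ζ)) :
    ∃ (MG : H₁ →L[ℂ] H₂) (MΓ : X →L[ℂ] H₂), (∀ h z, MG h z = G z (h z)) ∧
      (∀ x z, MΓ x z = Γ z x) ∧ MG ∘L adjoint MG + MΓ ∘L adjoint MΓ = .id ℂ H₂ := by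
  -- The adjoint of `[M_G, M_Γ]` has to send `K₂(·, ζ) y` to `(K₁(·, ζ) G(ζ)^* y, Γ(ζ)^* y)`. By
  -- `hK` this map preserves Gram operators, hence defines an isometry `W`; the multiplication
  -- operators are the adjoints of its two components.
  set b : Ω → Y →L[ℂ] WithLp 2 (H₁ × X) := fun ζ =>
    ((WithLp.prodContinuousLinearEquiv 2 ℂ H₁ X).symm : H₁ × X →L[ℂ] WithLp 2 (H₁ × X)) ∘L
      ((RKHS.kerFun H₁ ζ ∘L adjoint (G ζ)).prod (adjoint (Γ ζ))) with hb
  have b1 : ∀ ζ y, (b ζ y).fst = RKHS.kerFun H₁ ζ (adjoint (G ζ) y) := fun _ _ => rfl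
  have b2 : ∀ ζ y, (b ζ y).snd = adjoint (Γ ζ) y := fun _ _ => rfl
  obtain ⟨W, hW, hWn⟩ := exists_isometry_of_gram_eq (fun z => RKHS.kerFun H₂ z) b (fun z ζ y y' => by
    rw [WithLp.prod_inner_apply]
    simp only [WithLp.ofLp_fst, WithLp.ofLp_snd, b1, b2]
    rw [RKHS.kerFun_inner, RKHS.kerFun_inner, RKHS.kerFun_apply, RKHS.kerFun_apply, hK,
      adjoint_inner_left, adjoint_inner_left]
    simp [inner_add_right]) (RKHS.kerFun_dense H₂)
  have hWW : adjoint W ∘L W = 1 := (norm_map_iff_adjoint_comp_self W).1 hWn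
  set W₁ : H₂ →L[ℂ] H₁ := WithLp.fstL 2 ℂ H₁ X ∘L W with hW₁
  set W₂ : H₂ →L[ℂ] X := WithLp.sndL 2 ℂ H₁ X ∘L W with hW₂
  refine ⟨adjoint W₁, adjoint W₂, fun h z => ext_inner_left ℂ fun y => ?_,
    fun x z => ext_inner_left ℂ fun y => ?_, ?_⟩
  · rw [← RKHS.kerFun_inner, adjoint_inner_right]
    simp only [hW₁, comp_apply, hW]
    change ⟪(b z y).fst, h⟫_ℂ = _
    rw [b1, RKHS.kerFun_inner, adjoint_inner_left]
  · rw [← RKHS.kerFun_inner, adjoint_inner_right]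
    simp only [hW₂, comp_apply, hW]
    change ⟪(b z y).snd, x⟫_ℂ = _
    rw [b2, adjoint_inner_left]
  · ext1 h
    refine ext_inner_right ℂ fun k => ?_
    simp only [add_apply, comp_apply, adjoint_adjoint, id_apply, inner_add_left,
      adjoint_inner_left]
    calc ⟪W₁ h, W₁ k⟫_ℂ + ⟪W₂ h, W₂ k⟫_ℂ = ⟪W h, W k⟫_ℂ := by
          rw [WithLp.prod_inner_apply]; rfl
      _ = ⟪h, k⟫_ℂ := by
          rw [← adjoint_inner_left, ← comp_apply, hWW]; rfl

omit [RKHS ℂ H₁ Ω E] [RKHS ℂ H₂ Ω Y] in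
/-- If `[A, B]` is a coisometry, `B` is isometric and `A` is injective, then `A` is isometric. -/
lemma isometry_of_coisometry {A : H₁ →L[ℂ] H₂} {B : X →L[ℂ] H₂}
    (hAB : A ∘L adjoint A + B ∘L adjoint B = .id ℂ H₂) (hB : adjoint B ∘L B = .id ℂ X)
    (hA : Function.Injective A) : Isometry A := by
  have e1 : ∀ k, A (adjoint A k) + B (adjoint B k) = k := fun k => DFunLike.congr_fun hAB k
  have e2 : ∀ x, adjoint B (B x) = x := fun x => DFunLike.congr_fun hB x
  -- Applied to `B x`, the coisometry relation reads `A A^* B x + B x = B x`, and `A` can be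
  -- cancelled. The two ranges are then orthogonal, so the relation at `A h` becomes `A A^* A h = A
  -- h`.
  have e3 : ∀ x, adjoint A (B x) = 0 := fun x => hA (by
    have := e1 (B x)
    rw [e2] at this
    simpa using this)
  have e4 : ∀ h, adjoint A (A h) = h := fun h => hA (by
    have h1 : adjoint B (A h) = 0 := by
      refine ext_inner_right ℂ fun x => ?_
      rw [adjoint_inner_left, ← adjoint_inner_right, e3, inner_zero_right, inner_zero_left]
    have := e1 (A h)
    rwa [h1, map_zero, add_zero] at this)
  exact AddMonoidHomClass.isometry_of_norm A ((norm_map_iff_adjoint_comp_self A).2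
    (ContinuousLinearMap.ext e4))

end Kernel

/-! ### Holomorphy of the elements of de Branges–Rovnyak spaces -/

section Holomorphy

variable {U Y : Type*}
  [NormedAddCommGroup U] [InnerProductSpace ℂ U] [CompleteSpace U]
  [NormedAddCommGroup Y] [InnerProductSpace ℂ Y] [CompleteSpace Y]

/-- A bound for point evaluations on smaller disks, which turns norm convergence into locally
uniform convergence. -/
lemma norm_dbrKernel_self_le {S : 𝔻 → U →L[ℂ] Y} (hS : S ∈ schurClass U Y) (z : 𝔻) {r : ℝ}
    (hr : r < 1) (hz : ‖(z : ℂ)‖ ≤ r) : ‖dbrKernel S z z‖ ≤ 2 / (1 - r) := by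
  simp only [dbrKernel, Matrix.of_apply]
  have h0 := norm_nonneg (z : ℂ)
  have h1 : 1 - r ≤ ‖1 - (z : ℂ) * conj (z : ℂ)‖ := by
    refine le_trans ?_ (norm_sub_norm_le _ _)
    rw [norm_one, norm_mul, RCLike.norm_conj]
    nlinarith [z.norm_lt_one]
  have h2 : ‖ContinuousLinearMap.id ℂ Y - S z ∘L adjoint (S z)‖ ≤ 2 := by
    refine (norm_sub_le _ _).trans ?_
    have := (opNorm_comp_le (S z) (adjoint (S z)))
    rw [LinearIsometryEquiv.norm_map] at this
    have := norm_id_le (𝕜 := ℂ) (E := Y)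
    nlinarith [hS.2 z, norm_nonneg (S z)]
  rw [norm_smul, norm_inv, div_eq_inv_mul]
  have : 0 < 1 - r := by linarith
  gcongr

/-- The elements of a de Branges–Rovnyak space are holomorphic. -/
theorem holoDisk_of_kernel_eq_dbrKernel {S : 𝔻 → U →L[ℂ] Y} (hS : S ∈ schurClass U Y) {H : Type*}
    [NormedAddCommGroup H] [InnerProductSpace ℂ H] [CompleteSpace H] [RKHS ℂ H 𝔻 Y]
    (hK : RKHS.kernel H = dbrKernel S) (h : H) : HoloDisk ⇑h := by
  set ext : H → ℂ → Y := fun h w => if hw : ‖w‖ < 1 then h (.mk w hw) else 0 with hext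
  have ext_coe : ∀ (h : H) (z : 𝔻), ext h z = h z := fun h z => by
    simp [hext, z.norm_lt_one]
  have ext_of : ∀ h : H, HoloDisk ⇑h → DifferentiableOn ℂ (ext h) (ball 0 1) := by
    rintro h ⟨f, hf, hf'⟩
    refine hf.congr fun w hw => ?_
    have hw' : ‖w‖ < 1 := by simpa using hw
    simp [hext, hw', ← hf']
  suffices h' : DifferentiableOn ℂ (ext h) (ball 0 1) from ⟨ext h, h', ext_coe h⟩
  have hker : ∀ ζ y, HoloDisk ⇑(RKHS.kerFun H ζ y) := by
    intro ζ y
    have hSd : HoloDisk S := hS.1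
    have heq : ⇑(RKHS.kerFun H ζ y) = fun z : 𝔻 =>
        Ring.inverse (1 - (z : ℂ) * conj (ζ : ℂ)) • (y - S z (adjoint (S ζ) y)) := by
      funext z
      rw [RKHS.kerFun_apply, hK]
      simp [dbrKernel]
    rw [heq]
    refine .smul (.ringInverse ((HoloDisk.const 1).sub
      (HoloDisk.coe.smul (.const (conj (ζ : ℂ))))) fun z => ?_)
      ((HoloDisk.const y).sub (hSd.clm_apply (.const _)))
    rw [isUnit_iff_ne_zero, mul_comm]
    exact one_sub_conj_mul_ne_zero ζ.norm_lt_one z.norm_lt_one.le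
  -- The holomorphic elements form a closed subspace, since locally uniform limits are holomorphic,
  -- and it contains the kernel functions, whose span is dense.
  let M : Submodule ℂ H :=
    { carrier := {h | DifferentiableOn ℂ (ext h) (ball 0 1)}
      add_mem' := fun {a b} ha hb => ext_of _ (by
        rw [RKHS.coe_add]; exact HoloDisk.add ⟨_, ha, ext_coe a⟩ ⟨_, hb, ext_coe b⟩)
      zero_mem' := ext_of _ (by rw [RKHS.coe_zero]; exact .const 0)
      smul_mem' := fun c a ha => ext_of _ (by
        rw [RKHS.coe_smul]; exact HoloDisk.smul (.const c) ⟨_, ha, ext_coe a⟩) }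
  have hM : IsClosed (M : Set H) := by
    refine isClosed_of_closure_subset fun h hh => ?_
    obtain ⟨u, hu, hlim⟩ := mem_closure_iff_seq_limit.1 hh
    change DifferentiableOn ℂ (ext h) (ball 0 1)
    have hloc : TendstoLocallyUniformlyOn (fun n => ext (u n)) (ext h) atTop (ball 0 1) := by
      rw [tendstoLocallyUniformlyOn_iff_forall_isCompact isOpen_ball]
      intro K hKb hKc
      obtain ⟨r, hr1, hr⟩ : ∃ r < 1, ∀ w ∈ K, ‖w‖ ≤ r := by
        rcases K.eq_empty_or_nonempty with rfl | hne
        · exact ⟨0, one_pos, by simp⟩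
        · obtain ⟨w₀, hw₀, hmax⟩ := hKc.exists_isMaxOn hne continuous_norm.continuousOn
          exact ⟨‖w₀‖, by simpa using hKb hw₀, fun w hw => hmax hw⟩
      have := RKHS.tendstoUniformlyOn_of_norm_kerFun_le (H := H) (s := {z : 𝔻 | ‖(z : ℂ)‖ ≤ r})
        (C := √(2 / (1 - r))) (fun z hz => by
          rw [RKHS.norm_kerFun_eq_sqrt_norm_kernel, hK]
          exact Real.sqrt_le_sqrt (norm_dbrKernel_self_le hS z hr1 hz)) hlim
      rw [Metric.tendstoUniformlyOn_iff] at this ⊢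
      intro ε hε
      filter_upwards [this ε hε] with n hn w hw
      have hw1 : ‖w‖ < 1 := (hr w hw).trans_lt hr1
      have := hn (.mk w hw1) (by simpa using hr w hw)
      simpa [hext, hw1] using this
    exact hloc.differentiableOn (.of_forall hu) isOpen_ball
  have htop : (⊤ : Submodule ℂ H) ≤ M := by
    rw [← RKHS.kerFun_dense H]
    refine Submodule.topologicalClosure_minimal _ (Submodule.span_le.2 ?_) hM
    rintro _ ⟨ζ, y, rfl⟩
    exact ext_of _ (hker ζ y)
  exact htop (Submodule.mem_top (x := h))

end Holomorphy

lemma denseRange_codRestrict_topologicalClosure {E F : Type*} [NormedAddCommGroup E]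
    [NormedSpace ℂ E] [NormedAddCommGroup F] [NormedSpace ℂ F] (f : E →L[ℂ] F)
    (h : ∀ x, f x ∈ (LinearMap.range (f : E →ₗ[ℂ] F)).topologicalClosure) :
    DenseRange (f.codRestrict _ h) := by
  rintro ⟨y, hy⟩
  rw [closure_subtype]
  have : ((↑) '' Set.range (f.codRestrict _ h) : Set F) = Set.range f := by
    ext w; simp [Set.mem_image]
  rw [this]
  exact hy

/-! ### Rows of operators -/

section Row

variable {X Y Z W : Type*}
  [NormedAddCommGroup X] [InnerProductSpace ℂ X] [CompleteSpace X]
  [NormedAddCommGroup Y] [InnerProductSpace ℂ Y] [CompleteSpace Y]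
  [NormedAddCommGroup Z] [InnerProductSpace ℂ Z] [CompleteSpace Z]
  [NormedAddCommGroup W] [InnerProductSpace ℂ W] [CompleteSpace W]

/-- The row operator `[a, b, c]` on `(X ⊕ Y) ⊕ Z`. -/
def row (a : X →L[ℂ] W) (b : Y →L[ℂ] W) (c : Z →L[ℂ] W) :
    WithLp 2 (WithLp 2 (X × Y) × Z) →L[ℂ] W :=
  a ∘L WithLp.fstL 2 ℂ X Y ∘L WithLp.fstL 2 ℂ _ Z +
    b ∘L WithLp.sndL 2 ℂ X Y ∘L WithLp.fstL 2 ℂ _ Z + c ∘L WithLp.sndL 2 ℂ _ Z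

omit [CompleteSpace X] [CompleteSpace Y] [CompleteSpace Z] [CompleteSpace W] in
lemma row_apply (a : X →L[ℂ] W) (b : Y →L[ℂ] W) (c : Z →L[ℂ] W)
    (w : WithLp 2 (WithLp 2 (X × Y) × Z)) :
    row a b c w = a w.fst.fst + b w.fst.snd + c w.snd := rfl

lemma adjoint_row_apply (a : X →L[ℂ] W) (b : Y →L[ℂ] W) (c : Z →L[ℂ] W) (y : W) :
    adjoint (row a b c) y =
      WithLp.toLp 2 (WithLp.toLp 2 (adjoint a y, adjoint b y), adjoint c y) := by
  refine ext_inner_right ℂ fun w => ?_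
  rw [adjoint_inner_left, WithLp.prod_inner_apply, WithLp.prod_inner_apply, row_apply]
  simp [inner_add_right, adjoint_inner_left]

lemma row_comp_adjoint_row (a a' : X →L[ℂ] W) (b b' : Y →L[ℂ] W) (c c' : Z →L[ℂ] W) :
    row a b c ∘L adjoint (row a' b' c') =
      a ∘L adjoint a' + b ∘L adjoint b' + c ∘L adjoint c' := by
  ext y
  simp [adjoint_row_apply, row_apply]

end Row

/-- If `c (n + 1) ≤ q * (c n + δ n)` with `q < 1` and `δ` summable, then `c` tends to `0`. -/
lemma tendsto_zero_of_le_mul_add {q : ℝ} (hq0 : 0 ≤ q) (hq1 : q < 1) {c δ : ℕ → ℝ}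
    (hc : ∀ n, 0 ≤ c n) (hδ0 : ∀ n, 0 ≤ δ n) (hδ : Summable δ)
    (h : ∀ n, c (n + 1) ≤ q * (c n + δ n)) : Tendsto c atTop (𝓝 0) := by
  -- Summing the recursion gives `(1 - q) ∑ c ≤ c 0 + q ∑ δ`, so that `c` is even summable.
  refine Summable.tendsto_atTop_zero
    (summable_of_sum_range_le (c := (c 0 + q * ∑' n, δ n) / (1 - q)) hc fun n => ?_)
  rw [le_div_iff₀ (by linarith)]
  have h1 : ∑ k ∈ Finset.range n, c k ≤ c 0 + ∑ k ∈ Finset.range n, c (k + 1) := by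
    rw [add_comm, ← Finset.sum_range_succ']
    exact Finset.sum_le_sum_of_subset_of_nonneg (Finset.range_mono n.le_succ) fun _ _ _ => hc _
  have h2 : ∑ k ∈ Finset.range n, c (k + 1) ≤
      q * (∑ k ∈ Finset.range n, c k + ∑ k ∈ Finset.range n, δ k) := by
    rw [← Finset.sum_add_distrib, Finset.mul_sum]
    exact Finset.sum_le_sum fun k _ => h k
  have h3 : ∑ k ∈ Finset.range n, δ k ≤ ∑' n, δ n := hδ.sum_le_tsum _ fun _ _ => hδ0 _
  nlinarith [mul_le_mul_of_nonneg_left h3 hq0]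

/-- At a radius `r` with `‖z‖ < r < 1` the terms of the power series are bounded, so at `z` their
squares are dominated by a geometric series of ratio `(‖z‖ / r) ^ 2`. -/
lemma IsAnalyticOutputPair.summable_sq {X Z : Type*}
    [NormedAddCommGroup X] [InnerProductSpace ℂ X]
    [NormedAddCommGroup Z] [InnerProductSpace ℂ Z] {C : X →L[ℂ] Z} {T : X →L[ℂ] X}
    (h : IsAnalyticOutputPair C T) (x : X) (z : 𝔻) :
    Summable fun n : ℕ => (‖(z : ℂ)‖ ^ 2) ^ n * ‖C ((T ^ n) x)‖ ^ 2 := by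
  have hz := z.norm_lt_one
  have hz0 := norm_nonneg (z : ℂ)
  set r : ℝ := (1 + ‖(z : ℂ)‖) / 2 with hr
  have hr0 : 0 < r := by linarith
  have hrz : ‖(z : ℂ)‖ < r := by linarith
  obtain ⟨M, hM⟩ := (h x (.mk (r : ℂ) (by
    rw [Complex.norm_real, Real.norm_eq_abs, abs_of_pos hr0]; linarith))
    ).tendsto_atTop_zero.norm.bddAbove_range
  have hM' : ∀ n, r ^ n * ‖C ((T ^ n) x)‖ ≤ M := fun n => by
    have := hM ⟨n, rfl⟩
    simpa [norm_smul, abs_of_pos hr0] using this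
  have hq : (‖(z : ℂ)‖ / r) ^ 2 < 1 := by
    rw [sq_lt_one_iff₀ (by positivity)]
    exact (div_lt_one hr0).2 hrz
  refine Summable.of_nonneg_of_le (fun n => by positivity) (fun n => ?_)
    ((summable_geometric_of_lt_one (by positivity) hq).mul_left (M ^ 2))
  have h0 : 0 ≤ r ^ n * ‖C ((T ^ n) x)‖ := by positivity
  calc (‖(z : ℂ)‖ ^ 2) ^ n * ‖C ((T ^ n) x)‖ ^ 2
      = (r ^ n * ‖C ((T ^ n) x)‖) ^ 2 * ((‖(z : ℂ)‖ / r) ^ 2) ^ n := by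
        have hzr : ‖(z : ℂ)‖ ^ n = r ^ n * (‖(z : ℂ)‖ / r) ^ n := by
          rw [← mul_pow, mul_div_cancel₀ _ hr0.ne']
        rw [pow_right_comm, pow_right_comm (_ / r), hzr]
        ring
    _ ≤ M ^ 2 * ((‖(z : ℂ)‖ / r) ^ 2) ^ n := by
        gcongr
        exact hM' n

/-! ### The isometry `V` and the defect spaces -/

namespace Data

variable {X U Y : Type*}
  [NormedAddCommGroup X] [InnerProductSpace ℂ X] [CompleteSpace X]
  [NormedAddCommGroup U] [InnerProductSpace ℂ U] [CompleteSpace U]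
  [NormedAddCommGroup Y] [InnerProductSpace ℂ Y] [CompleteSpace Y]
  {D : Data X U Y}

lemma denseRange_toX₀ : DenseRange D.toX₀ := denseRange_codRestrict_topologicalClosure _ _

lemma denseRange_toDomV : DenseRange D.toDomV := denseRange_codRestrict_topologicalClosure _ _

lemma eq_zero_of_inner_toX₀ {x₀ : D.X₀} (h : ∀ x, ⟪D.toX₀ x, x₀⟫_ℂ = 0) : x₀ = 0 :=
  D.denseRange_toX₀.eq_zero_of_inner_right ℂ h

variable (hD : D.IsAdmissible)

include hD

lemma sqrtP_comp_sqrtP : D.sqrtP ∘L D.sqrtP = D.P :=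
  CFC.sqrt_mul_sqrt_self D.P ((ContinuousLinearMap.nonneg_iff_isPositive _).2 hD.isPositive)

omit hD in
lemma inner_sqrtP (x y : X) : ⟪D.sqrtP x, y⟫_ℂ = ⟪x, D.sqrtP y⟫_ℂ :=
  ((ContinuousLinearMap.nonneg_iff_isPositive _).1 (CFC.sqrt_nonneg D.P)).isSymmetric x y

lemma inner_toX₀_self (x : X) : (⟪D.P x, x⟫_ℂ).re = ‖D.toX₀ x‖ ^ 2 := by
  rw [← sqrtP_comp_sqrtP hD, comp_apply, inner_sqrtP]
  exact inner_self_eq_norm_sq (𝕜 := ℂ) (D.sqrtP x)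

/-- The quadratic form of the Stein equation. It makes `V` isometric and later controls the growth
of `P^{1/2} Tⁿ x`. -/
lemma norm_toX₀_T_sq_add (x : X) :
    ‖D.toX₀ (D.T x)‖ ^ 2 + ‖D.E x‖ ^ 2 = ‖D.toX₀ x‖ ^ 2 + ‖D.N x‖ ^ 2 := by
  have h := congrArg (fun L : X →L[ℂ] X => (⟪L x, x⟫_ℂ).re) hD.stein
  simp only [sub_apply, comp_apply, inner_sub_left, Complex.sub_re, adjoint_inner_left] at h
  rw [inner_toX₀_self hD, inner_toX₀_self hD] at h
  have h1 : (⟪D.E x, D.E x⟫_ℂ).re = ‖D.E x‖ ^ 2 := inner_self_eq_norm_sq (𝕜 := ℂ) _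
  have h2 : (⟪D.N x, D.N x⟫_ℂ).re = ‖D.N x‖ ^ 2 := inner_self_eq_norm_sq (𝕜 := ℂ) _
  rw [h1, h2] at h
  linarith

lemma norm_colOut (x : X) : ‖D.colOut x‖ = ‖D.toDomV x‖ := by
  change ‖D.colOut x‖ = ‖D.colIn x‖
  refine (sq_eq_sq₀ (norm_nonneg _) (norm_nonneg _)).1 ?_
  rw [WithLp.prod_norm_sq_eq_of_L2, WithLp.prod_norm_sq_eq_of_L2]
  exact norm_toX₀_T_sq_add hD x

lemma V_toDomV (x : X) : D.V (D.toDomV x) = D.colOut x :=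
  LinearMap.extendOfNorm_eq (f := (D.colOut : X →ₗ[ℂ] D.OutSpace))
    (e := (D.toDomV : X →ₗ[ℂ] D.domV)) denseRange_toDomV
    ⟨1, fun x => by rw [one_mul]; exact (norm_colOut hD x).le⟩ x

lemma norm_V (v : D.domV) : ‖D.V v‖ = ‖v‖ := by
  refine denseRange_toDomV.induction (P := fun v => ‖D.V v‖ = ‖v‖) ?_
    (isClosed_eq (by fun_prop) (by fun_prop)) v
  rintro _ ⟨x, rfl⟩
  rw [V_toDomV hD, norm_colOut hD]

lemma V_mem_ranV (v : D.domV) : D.V v ∈ D.ranV := by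
  refine denseRange_toDomV.induction (P := fun v => D.V v ∈ D.ranV) ?_
    ((Submodule.isClosed_topologicalClosure _).preimage D.V.continuous) v
  rintro _ ⟨x, rfl⟩
  rw [V_toDomV hD]
  exact Submodule.le_topologicalClosure _ ⟨x, rfl⟩

lemma exists_V_eq {y : D.OutSpace} (hy : y ∈ D.ranV) : ∃ v, D.V v = y := by
  have hcl : IsClosed (Set.range D.V) :=
    (AddMonoidHomClass.isometry_of_norm D.V (norm_V hD)).isClosedEmbedding.isClosed_range
  have : D.ranV ≤ LinearMap.range (D.V : D.domV →ₗ[ℂ] D.OutSpace) := by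
    refine Submodule.topologicalClosure_minimal _ ?_ hcl
    rintro _ ⟨x, rfl⟩
    exact ⟨D.toDomV x, V_toDomV hD x⟩
  exact this hy

omit hD in
lemma inner_colIn_Delta (x : X) (δ : D.Delta) :
    ⟪D.toX₀ x, (δ : D.InSpace).fst⟫_ℂ + ⟪D.N x, (δ : D.InSpace).snd⟫_ℂ = 0 :=
  (Submodule.mem_orthogonal _ _).1 δ.2 (D.colIn x) (Submodule.le_topologicalClosure _ ⟨x, rfl⟩)

omit hD in
lemma inner_colOut_DeltaStar (x : X) (δ : D.DeltaStar) :
    ⟪D.toX₀ (D.T x), (δ : D.OutSpace).fst⟫_ℂ + ⟪D.E x, (δ : D.OutSpace).snd⟫_ℂ = 0 :=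
  (Submodule.mem_orthogonal _ _).1 δ.2 (D.colOut x) (Submodule.le_topologicalClosure _ ⟨x, rfl⟩)

omit hD in
-- The first component is then orthogonal to the range of `P^{1/2}`, which is dense in `X₀`. This is
-- behind the dense range of `D₂₁`.
lemma Delta_eq_zero {δ : D.Delta} (h : (δ : D.InSpace).snd = 0) : δ = 0 := by
  have h1 : (δ : D.InSpace).fst = 0 := eq_zero_of_inner_toX₀ fun x => by
    simpa [h] using inner_colIn_Delta x δ
  refine Subtype.ext ((WithLp.ofLp_injective 2) (Prod.ext h1 h))

omit hD in
-- This is where the injectivity of `T^*` enters: orthogonality to `ℛ_V` reduces to `T^* P^{1/2} δ₁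
-- = 0` for the first component `δ₁`, hence `P^{1/2} δ₁ = 0`, hence `δ₁ = 0` by density.
lemma DeltaStar_eq_zero (hT : Function.Injective (adjoint D.T)) {δ : D.DeltaStar}
    (h : (δ : D.OutSpace).snd = 0) : δ = 0 := by
  have h2 : D.sqrtP ((δ : D.OutSpace).fst : X) = 0 := hT (by
    rw [map_zero]
    refine ext_inner_left ℂ fun x => ?_
    rw [adjoint_inner_right, ← inner_sqrtP, inner_zero_right]
    have := inner_colOut_DeltaStar x δ
    rwa [h, inner_zero_right, add_zero] at this)
  have h1 : (δ : D.OutSpace).fst = 0 := eq_zero_of_inner_toX₀ fun x => by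
    change ⟪D.sqrtP x, ((δ : D.OutSpace).fst : X)⟫_ℂ = 0
    rw [inner_sqrtP, h2, inner_zero_right]
  refine Subtype.ext ((WithLp.ofLp_injective 2) (Prod.ext h1 h))

end Data

namespace Data

variable {X U Y Δt Δst : Type*}
  [NormedAddCommGroup X] [InnerProductSpace ℂ X] [CompleteSpace X]
  [NormedAddCommGroup U] [InnerProductSpace ℂ U] [CompleteSpace U]
  [NormedAddCommGroup Y] [InnerProductSpace ℂ Y] [CompleteSpace Y]
  [NormedAddCommGroup Δt] [InnerProductSpace ℂ Δt] [CompleteSpace Δt]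
  [NormedAddCommGroup Δst] [InnerProductSpace ℂ Δst] [CompleteSpace Δst]
  (D : Data X U Y) (i : D.Delta ≃ₗᵢ[ℂ] Δt) (iStar : D.DeltaStar ≃ₗᵢ[ℂ] Δst)

/-! ### The colligation is unitary -/

lemma colligation_fst (w : WithLp 2 (D.InSpace × Δst)) :
    (D.colligation i iStar w).fst =
      D.V (D.domV.orthogonalProjectionOnto w.fst) + (iStar.symm w.snd : D.OutSpace) := rfl

lemma colligation_snd (w : WithLp 2 (D.InSpace × Δst)) :
    (D.colligation i iStar w).snd = i (D.Delta.orthogonalProjectionOnto w.fst) := rfl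

variable {D}

lemma norm_colligation (hD : D.IsAdmissible) (w : WithLp 2 (D.InSpace × Δst)) :
    ‖D.colligation i iStar w‖ = ‖w‖ := by
  refine (sq_eq_sq₀ (norm_nonneg _) (norm_nonneg _)).1 ?_
  rw [WithLp.prod_norm_sq_eq_of_L2, WithLp.prod_norm_sq_eq_of_L2 w]
  rw [colligation_fst, colligation_snd, LinearIsometryEquiv.norm_map]
  have h1 : ⟪D.V (D.domV.orthogonalProjectionOnto w.fst), (iStar.symm w.snd : D.OutSpace)⟫_ℂ = 0 :=
    (Submodule.mem_orthogonal _ _).1 (iStar.symm w.snd).2 _ (V_mem_ranV hD _)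
  rw [norm_add_sq (𝕜 := ℂ), h1, norm_V hD, Submodule.norm_coe, LinearIsometryEquiv.norm_map]
  have h2 := D.domV.norm_sq_eq_add_norm_sq_projection w.fst
  rw [h2]
  simp only [map_zero, mul_zero, add_zero]
  rw [add_right_comm]
  rfl

lemma colligation_surjective (hD : D.IsAdmissible) :
    Function.Surjective (D.colligation i iStar) := by
  intro y
  have hcl : CompleteSpace D.ranV :=
    inferInstanceAs
      (CompleteSpace (LinearMap.range (D.colOut : X →ₗ[ℂ] D.OutSpace)).topologicalClosure)
  obtain ⟨a, ha, b, hb, hab⟩ := D.ranV.exists_add_mem_mem_orthogonal y.fst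
  obtain ⟨v, rfl⟩ := exists_V_eq hD ha
  -- The preimage inverts the three pieces separately: `V` on `ℛ_V`, `i_*^*` on `Δ_*` and `i` on
  -- `Δ̃`.
  refine ⟨WithLp.toLp 2 ((v : D.InSpace) + (i.symm y.snd : D.InSpace), iStar ⟨b, hb⟩), ?_⟩
  refine WithLp.ofLp_injective 2 (Prod.ext ?_ ?_)
  · change (D.colligation i iStar _).fst = y.fst
    rw [colligation_fst, hab]
    simp only [WithLp.toLp_fst, WithLp.toLp_snd, map_add, LinearIsometryEquiv.symm_apply_apply]
    rw [Submodule.orthogonalProjectionOnto_mem_subspace_eq_self,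
      Submodule.orthogonalProjectionOnto_apply_of_mem_orthogonal
        (i.symm y.snd).2, map_zero, add_zero]
  · change (D.colligation i iStar _).snd = y.snd
    rw [colligation_snd]
    simp only [WithLp.toLp_fst, map_add]
    rw [Submodule.orthogonalProjectionOnto_mem_subspace_eq_self,
      Submodule.orthogonalProjectionOnto_apply_of_mem_orthogonal
        (K := D.Delta) (D.domV.le_orthogonal_orthogonal v.2)]
    simp

lemma colligation_comp_adjoint (hD : D.IsAdmissible) :
    D.colligation i iStar ∘L adjoint (D.colligation i iStar) = .id ℂ _ := by
  have h1 := (norm_map_iff_adjoint_comp_self (D.colligation i iStar)).1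
    (norm_colligation i iStar hD)
  ext1 y
  obtain ⟨w, rfl⟩ := colligation_surjective i iStar hD y
  have : adjoint (D.colligation i iStar) (D.colligation i iStar w) = w := DFunLike.congr_fun h1 w
  rw [comp_apply, this, id_apply]

/-! ### The blocks of the colligation -/

lemma eq_inX_add_inU_add_inΔ (w : WithLp 2 (D.InSpace × Δst)) :
    w = D.inX Δst w.fst.fst + D.inU Δst w.fst.snd + D.inΔ Δst w.snd := by
  refine WithLp.ofLp_injective 2 (Prod.ext (WithLp.ofLp_injective 2 (Prod.ext ?_ ?_)) ?_) <;>
    simp [inX, inU, inΔ]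

lemma colligation_fst_fst (w : WithLp 2 (D.InSpace × Δst)) :
    (D.colligation i iStar w).fst.fst =
      D.A i iStar w.fst.fst + D.B₁ i iStar w.fst.snd + D.B₂ i iStar w.snd := by
  change D.outX Δt (D.colligation i iStar w) = _
  conv_lhs => rw [eq_inX_add_inU_add_inΔ w, map_add, map_add, map_add, map_add]
  rfl

lemma colligation_fst_snd (w : WithLp 2 (D.InSpace × Δst)) :
    (D.colligation i iStar w).fst.snd =
      D.C₁ i iStar w.fst.fst + D.D₁₁ i iStar w.fst.snd + D.D₁₂ i iStar w.snd := by
  change D.outY Δt (D.colligation i iStar w) = _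
  conv_lhs => rw [eq_inX_add_inU_add_inΔ w, map_add, map_add, map_add, map_add]
  rfl

lemma colligation_snd_eq (w : WithLp 2 (D.InSpace × Δst)) :
    (D.colligation i iStar w).snd =
      D.C₂ i iStar w.fst.fst + D.D₂₁ i iStar w.fst.snd + D.D₂₂ i iStar w.snd := by
  change D.outΔ Δt (D.colligation i iStar w) = _
  conv_lhs => rw [eq_inX_add_inU_add_inΔ w, map_add, map_add, map_add, map_add]
  rfl

lemma norm_sq_blocks (hD : D.IsAdmissible) (x : D.X₀) (u : U) (d : Δst) :
    ‖D.A i iStar x + D.B₁ i iStar u + D.B₂ i iStar d‖ ^ 2 +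
      ‖D.C₁ i iStar x + D.D₁₁ i iStar u + D.D₁₂ i iStar d‖ ^ 2 +
      ‖D.C₂ i iStar x + D.D₂₁ i iStar u + D.D₂₂ i iStar d‖ ^ 2 =
    ‖x‖ ^ 2 + ‖u‖ ^ 2 + ‖d‖ ^ 2 := by
  set w : WithLp 2 (D.InSpace × Δst) := WithLp.toLp 2 (WithLp.toLp 2 (x, u), d) with hw
  have h := congrArg (· ^ 2) (norm_colligation i iStar hD w)
  simp only [WithLp.prod_norm_sq_eq_of_L2] at h
  rw [colligation_fst_fst, colligation_fst_snd, colligation_snd_eq] at h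
  exact h

lemma D₂₂_eq_zero : D.D₂₂ i iStar = 0 := by
  ext d
  change (D.colligation i iStar (D.inΔ Δst d)).snd = 0
  rw [colligation_snd]
  have : (D.inΔ Δst d).fst = 0 := rfl
  rw [this, map_zero, map_zero]

lemma D₁₂_injective (hT : Function.Injective (adjoint D.T)) :
    Function.Injective (D.D₁₂ i iStar) := by
  refine (injective_iff_map_eq_zero _).2 fun d hd => ?_
  have h1 : (iStar.symm d : D.OutSpace).snd = 0 := by
    rw [← hd]
    change _ = (D.colligation i iStar (D.inΔ Δst d)).fst.snd
    rw [colligation_fst]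
    have h1 : (D.inΔ Δst d).fst = 0 := rfl
    have h2 : (D.inΔ Δst d).snd = d := rfl
    rw [h1, h2, map_zero, map_zero, zero_add]
  have := DeltaStar_eq_zero hT h1
  rwa [LinearIsometryEquiv.map_eq_zero_iff] at this

/-- The dense range of `D₂₁`, in cancellation form: `D₂₁ u = i P_Δ (0, u)`, so a vector `i δ`
orthogonal to every `D₂₁ u` has `δ` with zero `U`-component, and then `δ = 0`. -/
lemma eq_zero_of_comp_D₂₁ {Z : Type*} [NormedAddCommGroup Z] [InnerProductSpace ℂ Z]
    [CompleteSpace Z] {Φ : Δt →L[ℂ] Z} (h : Φ ∘L D.D₂₁ i iStar = 0) : Φ = 0 := by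
  have key : ∀ t : Δt, (∀ u, ⟪t, D.D₂₁ i iStar u⟫_ℂ = 0) → t = 0 := by
    intro t ht
    obtain ⟨δ, rfl⟩ := i.surjective t
    rw [Delta_eq_zero (δ := δ), map_zero]
    refine ext_inner_right ℂ fun u => ?_
    have h1 := ht u
    change ⟪i δ, (D.colligation i iStar (D.inU Δst u)).snd⟫_ℂ = 0 at h1
    rw [colligation_snd] at h1
    have h0 : ∀ a b : D.Delta, ⟪i a, i b⟫_ℂ = ⟪a, b⟫_ℂ :=
      LinearIsometryEquiv.inner_map_map (𝕜 := ℂ) (E := D.Delta) (E' := Δt) i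
    rw [h0, Submodule.inner_orthogonalProjectionOnto_eq_of_mem_left, WithLp.prod_inner_apply] at h1
    have h2 : (D.inU Δst u).fst.ofLp.fst = 0 := rfl
    have h3 : (D.inU Δst u).fst.ofLp.snd = u := rfl
    rw [h2, h3, inner_zero_right, zero_add] at h1
    rw [inner_zero_left]
    exact h1
  have h2 : adjoint Φ = 0 := by
    ext z
    refine key _ fun u => ?_
    rw [adjoint_inner_left, ← comp_apply, h, zero_apply, inner_zero_right]
  rw [← adjoint_adjoint Φ, h2, map_zero]

lemma colligation_colIn (hD : D.IsAdmissible) (x : X) :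
    D.colligation i iStar (WithLp.toLp 2 (D.colIn x, 0)) = WithLp.toLp 2 (D.colOut x, 0) := by
  have hx : D.colIn x = (D.toDomV x : D.InSpace) := rfl
  refine WithLp.ofLp_injective 2 (Prod.ext ?_ ?_)
  · change (D.colligation i iStar _).fst = D.colOut x
    rw [colligation_fst]
    simp only [WithLp.toLp_fst, WithLp.toLp_snd, map_zero, Submodule.coe_zero, add_zero]
    rw [hx, Submodule.orthogonalProjectionOnto_mem_subspace_eq_self, V_toDomV hD]
  · change (D.colligation i iStar _).snd = 0
    rw [colligation_snd]
    simp only [WithLp.toLp_fst]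
    rw [hx, Submodule.orthogonalProjectionOnto_apply_of_mem_orthogonal
        (K := D.Delta) (D.domV.le_orthogonal_orthogonal (D.toDomV x).2), map_zero]

end Data

lemma re_inner_self_eq_norm_sq {H : Type*} [NormedAddCommGroup H] [InnerProductSpace ℂ H] (a : H) :
    (⟪a, a⟫_ℂ).re = ‖a‖ ^ 2 :=
  inner_self_eq_norm_sq (𝕜 := ℂ) a

lemma comp_adjoint_eq_of_coisometry {H K W : Type*}
    [NormedAddCommGroup H] [InnerProductSpace ℂ H] [CompleteSpace H]
    [NormedAddCommGroup K] [InnerProductSpace ℂ K] [CompleteSpace K]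
    [NormedAddCommGroup W] [InnerProductSpace ℂ W] [CompleteSpace W]
    {C : H →L[ℂ] K} (hC : C ∘L adjoint C = .id ℂ K) {R R' : K →L[ℂ] W} {T T' : H →L[ℂ] W}
    (h : R ∘L C = T) (h' : R' ∘L C = T') : R ∘L adjoint R' = T ∘L adjoint T' := by
  rw [← h, ← h', adjoint_comp, comp_assoc, ← comp_assoc C, hC, id_comp]

namespace Data

variable {X U Y Δt Δst : Type*}
  [NormedAddCommGroup X] [InnerProductSpace ℂ X] [CompleteSpace X]
  [NormedAddCommGroup U] [InnerProductSpace ℂ U] [CompleteSpace U]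
  [NormedAddCommGroup Y] [InnerProductSpace ℂ Y] [CompleteSpace Y]
  [NormedAddCommGroup Δt] [InnerProductSpace ℂ Δt] [CompleteSpace Δt]
  [NormedAddCommGroup Δst] [InnerProductSpace ℂ Δst] [CompleteSpace Δst]
  {D : Data X U Y} (i : D.Delta ≃ₗᵢ[ℂ] Δt) (iStar : D.DeltaStar ≃ₗᵢ[ℂ] Δst)

/-! ### The characteristic function -/

lemma norm_A_le (hD : D.IsAdmissible) : ‖D.A i iStar‖ ≤ 1 := by
  refine opNorm_le_bound _ zero_le_one fun x => ?_
  have h := norm_sq_blocks i iStar hD x 0 0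
  simp only [map_zero, add_zero, norm_zero] at h
  rw [one_mul]
  refine le_of_sq_le_sq ?_ (norm_nonneg _)
  nlinarith [sq_nonneg ‖D.C₁ i iStar x‖, sq_nonneg ‖D.C₂ i iStar x‖]

lemma isUnit_one_sub_smul_A (hD : D.IsAdmissible) (z : 𝔻) :
    IsUnit (1 - (z : ℂ) • D.A i iStar) := by
  refine isUnit_one_sub_of_norm_lt_one (R := D.X₀ →L[ℂ] D.X₀) ((opNorm_smul_le _ _).trans_lt ?_)
  nlinarith [norm_A_le i iStar hD, norm_nonneg (D.A i iStar), z.norm_lt_one, norm_nonneg (z : ℂ)]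

lemma resolventA_apply (hD : D.IsAdmissible) (z : 𝔻) (x : D.X₀) :
    D.resolventA i iStar z x = (z : ℂ) • D.A i iStar (D.resolventA i iStar z x) + x := by
  have h := DFunLike.congr_fun
    (Ring.mul_inverse_cancel _ (isUnit_one_sub_smul_A i iStar hD z)) x
  have h' : D.resolventA i iStar z x - (z : ℂ) • D.A i iStar (D.resolventA i iStar z x) = x := h
  rw [← sub_eq_iff_eq_add', h']

lemma resolventA_apply_sub (hD : D.IsAdmissible) (z : 𝔻) (x : D.X₀) :
    D.resolventA i iStar z (x - (z : ℂ) • D.A i iStar x) = x :=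
  DFunLike.congr_fun (Ring.inverse_mul_cancel _ (isUnit_one_sub_smul_A i iStar hD z)) x

lemma holoDisk_resolventA (hD : D.IsAdmissible) : HoloDisk (D.resolventA i iStar) :=
  HoloDisk.ringInverse (R := D.X₀ →L[ℂ] D.X₀)
    ((HoloDisk.const 1).sub (HoloDisk.coe.smul (.const (D.A i iStar)))) (isUnit_one_sub_smul_A i iStar hD)

lemma holoDisk_Sigma₁₁ (hD : D.IsAdmissible) : HoloDisk (D.Sigma₁₁ i iStar) :=
  (HoloDisk.const _).add (HoloDisk.coe.smul
    ((HoloDisk.const _).clm_comp ((holoDisk_resolventA i iStar hD).clm_comp (.const _))))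

lemma holoDisk_Sigma₁₂ (hD : D.IsAdmissible) : HoloDisk (D.Sigma₁₂ i iStar) :=
  (HoloDisk.const _).add (HoloDisk.coe.smul
    ((HoloDisk.const _).clm_comp ((holoDisk_resolventA i iStar hD).clm_comp (.const _))))

lemma holoDisk_Sigma₂₁ (hD : D.IsAdmissible) : HoloDisk (D.Sigma₂₁ i iStar) :=
  (HoloDisk.const _).add (HoloDisk.coe.smul
    ((HoloDisk.const _).clm_comp ((holoDisk_resolventA i iStar hD).clm_comp (.const _))))

lemma holoDisk_Sigma₂₂ (hD : D.IsAdmissible) : HoloDisk (D.Sigma₂₂ i iStar) :=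
  (HoloDisk.const _).add (HoloDisk.coe.smul
    ((HoloDisk.const _).clm_comp ((holoDisk_resolventA i iStar hD).clm_comp (.const _))))

/-- With `x = (I - zA)⁻¹ B₂ d`, the colligation sends the input `(z x, 0, d)` to the state `x` and
the `Δ̃`-output `Σ₂₂(z) d`. Energy balance and `‖z x‖ ≤ ‖x‖` give the bound. -/
lemma norm_Sigma₂₂_le_one (hD : D.IsAdmissible) (z : 𝔻) : ‖D.Sigma₂₂ i iStar z‖ ≤ 1 := by
  refine opNorm_le_bound _ zero_le_one fun d => ?_
  set x := D.resolventA i iStar z (D.B₂ i iStar d) with hx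
  have h := norm_sq_blocks i iStar hD ((z : ℂ) • x) 0 d
  have h1 : D.A i iStar ((z : ℂ) • x) + D.B₂ i iStar d = x := by
    rw [map_smul, hx, ← resolventA_apply i iStar hD]
  have h2 : D.C₂ i iStar ((z : ℂ) • x) + D.D₂₂ i iStar d = D.Sigma₂₂ i iStar z d := by
    rw [map_smul, add_comm]; rfl
  simp only [map_zero, add_zero, norm_zero] at h
  rw [h1, h2, norm_smul, mul_pow] at h
  rw [one_mul]
  refine le_of_sq_le_sq ?_ (norm_nonneg _)
  nlinarith [sq_nonneg ‖D.C₁ i iStar ((z : ℂ) • x) + D.D₁₂ i iStar d‖, sq_nonneg ‖x‖,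
    z.sq_norm_lt_one]

lemma Sigma₁₂_zero : D.Sigma₁₂ i iStar 0 = D.D₁₂ i iStar := by
  simp [Sigma₁₂]

lemma Sigma₂₁_zero : D.Sigma₂₁ i iStar 0 = D.D₂₁ i iStar := by
  simp [Sigma₂₁]

lemma Sigma₂₂_zero : D.Sigma₂₂ i iStar 0 = 0 := by
  simp [Sigma₂₂, D₂₂_eq_zero]

/-- The Schwarz lemma, available because `D₂₂ = 0`. The strict inequality makes `I - ℰ Σ₂₂`
invertible for every Schur function `ℰ`. -/
lemma norm_Sigma₂₂_lt_one (hD : D.IsAdmissible) (z : 𝔻) : ‖D.Sigma₂₂ i iStar z‖ < 1 := by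
  obtain ⟨f, hf, hf'⟩ := holoDisk_Sigma₂₂ i iStar hD
  have h0 : f 0 = 0 := by
    rw [← Complex.UnitDisc.coe_zero, hf', Sigma₂₂_zero]
  have hmaps : Set.MapsTo f (ball 0 1) (closedBall 0 1) := fun w hw => by
    have := norm_Sigma₂₂_le_one i iStar hD (.mk w (by simpa using hw))
    rw [← hf', Complex.UnitDisc.coe_mk] at this
    simpa using this
  rw [← hf']
  exact (Complex.norm_le_norm_of_mapsTo_ball hf hmaps h0 z.norm_lt_one).trans_lt z.norm_lt_one

variable {ℰ : 𝔻 → Δt →L[ℂ] Δst}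

lemma isUnit_one_sub_comp_Sigma₂₂ (hD : D.IsAdmissible) (hℰ : ℰ ∈ schurClass Δt Δst) (z : 𝔻) :
    IsUnit (1 - ℰ z ∘L D.Sigma₂₂ i iStar z) := by
  refine isUnit_one_sub_of_norm_lt_one ((opNorm_comp_le _ _).trans_lt ?_)
  nlinarith [hℰ.2 z, norm_Sigma₂₂_lt_one i iStar hD z, norm_nonneg (ℰ z),
    norm_nonneg (D.Sigma₂₂ i iStar z)]

lemma holoDisk_G (hD : D.IsAdmissible) (hℰ : ℰ ∈ schurClass Δt Δst) :
    HoloDisk (D.G i iStar ℰ) := by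
  have h : HoloDisk ℰ := hℰ.1
  exact (holoDisk_Sigma₁₂ i iStar hD).clm_comp (.ringInverse
    ((HoloDisk.const 1).sub (h.clm_comp (holoDisk_Sigma₂₂ i iStar hD)))
    (isUnit_one_sub_comp_Sigma₂₂ i iStar hD hℰ))

lemma redheffer_eq (z : 𝔻) : D.redheffer i iStar ℰ z =
    D.Sigma₁₁ i iStar z + D.G i iStar ℰ z ∘L ℰ z ∘L D.Sigma₂₁ i iStar z := rfl

lemma holoDisk_redheffer (hD : D.IsAdmissible) (hℰ : ℰ ∈ schurClass Δt Δst) :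
    HoloDisk (D.redheffer i iStar ℰ) := by
  have h : HoloDisk ℰ := hℰ.1
  exact (holoDisk_Sigma₁₁ i iStar hD).add ((holoDisk_G i iStar hD hℰ).clm_comp
    (h.clm_comp (holoDisk_Sigma₂₁ i iStar hD)))

lemma G_apply_sub (hD : D.IsAdmissible) (hℰ : ℰ ∈ schurClass Δt Δst) (z : 𝔻) (d : Δst) :
    D.G i iStar ℰ z (d - ℰ z (D.Sigma₂₂ i iStar z d)) = D.Sigma₁₂ i iStar z d := by
  have h := DFunLike.congr_fun
    (Ring.inverse_mul_cancel _ (isUnit_one_sub_comp_Sigma₂₂ i iStar hD hℰ z)) d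
  exact congrArg (D.Sigma₁₂ i iStar z) h

lemma G_zero_injective (hT : Function.Injective (adjoint D.T)) :
    Function.Injective (D.G i iStar ℰ 0) := by
  have : D.G i iStar ℰ 0 = D.D₁₂ i iStar := by
    rw [G, Sigma₁₂_zero, Sigma₂₂_zero, comp_zero, sub_zero, Ring.inverse_one]
    rfl
  rw [this]
  exact D₁₂_injective i iStar hT

/-! ### The observability function of the closed loop system -/

variable (ℰ) in
/-- The function `Γ(z) = (C₁ + G(z) ℰ(z) C₂) (I - z A)⁻¹`. -/
def closedLoopObs (z : 𝔻) : D.X₀ →L[ℂ] Y :=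
  (D.C₁ i iStar + D.G i iStar ℰ z ∘L ℰ z ∘L D.C₂ i iStar) ∘L D.resolventA i iStar z

/-- The row identity `[z Γ(z), I, G(z) ℰ(z)] 𝐔 = [Γ(z), S(z), G(z)]`. -/
lemma row_comp_colligation (hD : D.IsAdmissible) (hℰ : ℰ ∈ schurClass Δt Δst) (z : 𝔻) :
    (row ((z : ℂ) • closedLoopObs i iStar ℰ z) (.id ℂ Y) (D.G i iStar ℰ z ∘L ℰ z) :
        WithLp 2 (D.OutSpace × Δt) →L[ℂ] Y) ∘L D.colligation i iStar =
      row (closedLoopObs i iStar ℰ z) (D.redheffer i iStar ℰ z) (D.G i iStar ℰ z) := by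
  ext1 w
  rw [comp_apply, row_apply, row_apply, colligation_fst_fst, colligation_fst_snd,
    colligation_snd_eq]
  set x := w.fst.fst
  set u := w.fst.snd
  set d := w.snd
  have h1 : closedLoopObs i iStar ℰ z x = (z : ℂ) • closedLoopObs i iStar ℰ z (D.A i iStar x) +
      (D.C₁ i iStar x + D.G i iStar ℰ z (ℰ z (D.C₂ i iStar x))) := by
    have h : closedLoopObs i iStar ℰ z (x - (z : ℂ) • D.A i iStar x) =
        D.C₁ i iStar x + D.G i iStar ℰ z (ℰ z (D.C₂ i iStar x)) := by
      rw [closedLoopObs, comp_apply, resolventA_apply_sub i iStar hD]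
      rfl
    rw [← h, map_sub, map_smul, add_sub_cancel]
  have h2 : D.redheffer i iStar ℰ z u = (z : ℂ) • closedLoopObs i iStar ℰ z (D.B₁ i iStar u) +
      (D.D₁₁ i iStar u + D.G i iStar ℰ z (ℰ z (D.D₂₁ i iStar u))) := by
    simp only [redheffer_eq, Sigma₁₁, Sigma₂₁, closedLoopObs, add_apply, smul_apply, comp_apply,
      map_add, map_smul, smul_add]
    abel
  have h3 : D.G i iStar ℰ z d = (z : ℂ) • closedLoopObs i iStar ℰ z (D.B₂ i iStar d) +
      (D.D₁₂ i iStar d + D.G i iStar ℰ z (ℰ z (D.D₂₂ i iStar d))) := by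
    have h := G_apply_sub i iStar hD hℰ z d
    rw [map_sub, sub_eq_iff_eq_add] at h
    rw [h]
    simp only [Sigma₁₂, Sigma₂₂, closedLoopObs, add_apply, smul_apply, comp_apply,
      map_add, map_smul, smul_add]
    abel
  rw [h1, h2, h3]
  simp only [smul_apply, map_add, id_apply, comp_apply]
  abel

/-- The row identity at `z` times the adjoint of the row identity at `ζ`, with `𝐔𝐔^* = I` cancelled
in the middle. -/
lemma closedLoop_identity (hD : D.IsAdmissible) (hℰ : ℰ ∈ schurClass Δt Δst) (z ζ : 𝔻) :
    ((z : ℂ) * conj (ζ : ℂ)) • (closedLoopObs i iStar ℰ z ∘L adjoint (closedLoopObs i iStar ℰ ζ)) +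
      .id ℂ Y + D.G i iStar ℰ z ∘L (ℰ z ∘L adjoint (ℰ ζ)) ∘L adjoint (D.G i iStar ℰ ζ) =
    closedLoopObs i iStar ℰ z ∘L adjoint (closedLoopObs i iStar ℰ ζ) +
      D.redheffer i iStar ℰ z ∘L adjoint (D.redheffer i iStar ℰ ζ) +
      D.G i iStar ℰ z ∘L adjoint (D.G i iStar ℰ ζ) := by
  rw [← row_comp_adjoint_row, ← comp_adjoint_eq_of_coisometry (colligation_comp_adjoint i iStar hD)
    (row_comp_colligation i iStar hD hℰ z) (row_comp_colligation i iStar hD hℰ ζ),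
    row_comp_adjoint_row]
  ext y
  simp [map_smulₛₗ, adjoint_comp, adjoint_id, smul_smul, mul_comm]

/-- `closedLoop_identity` rearranged and divided by `1 - z * conj ζ`. -/
lemma dbrKernel_redheffer (hD : D.IsAdmissible) (hℰ : ℰ ∈ schurClass Δt Δst) (z ζ : 𝔻) :
    dbrKernel (D.redheffer i iStar ℰ) z ζ =
      D.G i iStar ℰ z ∘L dbrKernel ℰ z ζ ∘L adjoint (D.G i iStar ℰ ζ) +
        closedLoopObs i iStar ℰ z ∘L adjoint (closedLoopObs i iStar ℰ ζ) := by
  have h0 : 1 - (z : ℂ) * conj (ζ : ℂ) ≠ 0 := by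
    rw [mul_comm]
    exact one_sub_conj_mul_ne_zero ζ.norm_lt_one z.norm_lt_one.le
  ext y
  have h := DFunLike.congr_fun (closedLoop_identity i iStar hD hℰ z ζ) y
  simp only [add_apply, smul_apply, comp_apply, id_apply] at h
  simp only [dbrKernel, Matrix.of_apply, add_apply, smul_apply, comp_apply, sub_apply, id_apply,
    map_smul, map_sub]
  rw [inv_smul_eq_iff₀ h0, smul_add, smul_inv_smul₀ h0, sub_smul, one_smul]
  rw [← sub_eq_zero] at h ⊢
  rw [← h]
  abel

/-- The Redheffer transform maps the Schur class to the Schur class. -/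
lemma redheffer_mem_schurClass (hD : D.IsAdmissible) (hℰ : ℰ ∈ schurClass Δt Δst) :
    D.redheffer i iStar ℰ ∈ schurClass U Y := by
  refine ⟨holoDisk_redheffer i iStar hD hℰ, fun z => ?_⟩
  rw [← LinearIsometryEquiv.norm_map adjoint (D.redheffer i iStar ℰ z)]
  refine opNorm_le_bound _ zero_le_one fun y => ?_
  rw [one_mul]
  refine le_of_sq_le_sq ?_ (norm_nonneg _)
  -- On the diagonal, `|z|²‖Γ^* y‖² + ‖y‖² + ‖ℰ^* G^* y‖² = ‖Γ^* y‖² + ‖S^* y‖² + ‖G^* y‖²`. Since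
  -- `|z| < 1` and `‖ℰ^*‖ ≤ 1`, this forces `‖S^* y‖ ≤ ‖y‖`.
  have h := congrArg (fun L : Y →L[ℂ] Y => (⟪y, L y⟫_ℂ).re) (closedLoop_identity i iStar hD hℰ z z)
  simp only [add_apply, smul_apply, comp_apply, id_apply, inner_add_right, inner_smul_right,
    ← adjoint_inner_left (closedLoopObs i iStar ℰ z),
    ← adjoint_inner_left (D.redheffer i iStar ℰ z), ← adjoint_inner_left (D.G i iStar ℰ z),
    ← adjoint_inner_left (ℰ z), Complex.add_re, Complex.mul_conj, Complex.re_ofReal_mul,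
    Complex.normSq_eq_norm_sq, re_inner_self_eq_norm_sq] at h
  nlinarith [sq_nonneg ‖adjoint (closedLoopObs i iStar ℰ z) y‖, z.sq_norm_lt_one,
    sq_nonneg ‖adjoint (D.G i iStar ℰ z) y‖,
    pow_le_pow_left₀ (norm_nonneg _) (le_of_opNorm_le (adjoint (ℰ z))
      ((LinearIsometryEquiv.norm_map adjoint (ℰ z)).trans_le (hℰ.2 z))
      (adjoint (D.G i iStar ℰ z) y)) 2]

/-! ### The function `F^S` -/

/-- The row identity evaluated at `(P^{1/2} x, N x, 0)`, where `𝐔` acts as `V`. -/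
lemma closedLoopObs_toX₀ (hD : D.IsAdmissible) (hℰ : ℰ ∈ schurClass Δt Δst) (z : 𝔻) (x : X) :
    closedLoopObs i iStar ℰ z (D.toX₀ x) =
      (z : ℂ) • closedLoopObs i iStar ℰ z (D.toX₀ (D.T x)) +
        (D.E x - D.redheffer i iStar ℰ z (D.N x)) := by
  have h := DFunLike.congr_fun (row_comp_colligation i iStar hD hℰ z)
    (WithLp.toLp 2 (D.colIn x, 0))
  rw [comp_apply, colligation_colIn i iStar hD, row_apply, row_apply] at h
  have h' : (z : ℂ) • closedLoopObs i iStar ℰ z (D.toX₀ (D.T x)) + D.E x +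
      (D.G i iStar ℰ z ∘L ℰ z) 0 = closedLoopObs i iStar ℰ z (D.toX₀ x) +
      D.redheffer i iStar ℰ z (D.N x) + D.G i iStar ℰ z 0 := h
  rw [map_zero, map_zero, add_zero, add_zero] at h'
  rw [← add_sub_assoc, h', add_sub_cancel_right]

/-- Dropping the `E` term in the Stein identity bounds the growth of `‖P^{1/2} Tⁿ x‖²` by `‖N Tⁿ
x‖²`; weighted by `|z|^{2n}`, the latter are summable, so the recursion has ratio `|z|² < 1`. -/
lemma tendsto_pow_smul_toX₀ (hD : D.IsAdmissible) (z : 𝔻) (x : X) :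
    Tendsto (fun n : ℕ => (z : ℂ) ^ n • D.toX₀ ((D.T ^ n) x)) atTop (𝓝 0) := by
  have h := tendsto_zero_of_le_mul_add (q := ‖(z : ℂ)‖ ^ 2)
    (c := fun n => (‖(z : ℂ)‖ ^ 2) ^ n * ‖D.toX₀ ((D.T ^ n) x)‖ ^ 2)
    (sq_nonneg _) z.sq_norm_lt_one (fun n => by positivity) (fun n => by positivity)
    (hD.analytic_N.summable_sq x z) (fun n => by
      have h1 := norm_toX₀_T_sq_add hD ((D.T ^ n) x)
      have h2 : (D.T ^ (n + 1)) x = D.T ((D.T ^ n) x) := by rw [pow_succ']; rfl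
      rw [h2, pow_succ, mul_comm (_ ^ n), mul_assoc, ← mul_add]
      gcongr
      nlinarith [sq_nonneg ‖D.E ((D.T ^ n) x)‖])
  rw [tendsto_zero_iff_norm_tendsto_zero]
  have h' := h.sqrt
  rw [Real.sqrt_zero] at h'
  refine h'.congr fun n => ?_
  rw [norm_smul, norm_pow, ← pow_mul, mul_comm 2 n, pow_mul, ← mul_pow,
    Real.sqrt_sq (by positivity)]

/-- Since `I - zT` need not be invertible, `closedLoopObs_toX₀` is iterated along `Tⁿ x`: the
partial sums of `F^S(z) x` telescope, with a remainder that tends to `0`. -/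
lemma closedLoopObs_toX₀_eq_F (hD : D.IsAdmissible) (hℰ : ℰ ∈ schurClass Δt Δst) (z : 𝔻) (x : X) :
    closedLoopObs i iStar ℰ z (D.toX₀ x) = D.F (D.redheffer i iStar ℰ) z x := by
  set S := D.redheffer i iStar ℰ with hS
  set Γ := closedLoopObs i iStar ℰ z with hΓ
  have hpart : ∀ n : ℕ, ∑ k ∈ Finset.range n,
      ((z : ℂ) ^ k • D.E ((D.T ^ k) x) - S z ((z : ℂ) ^ k • D.N ((D.T ^ k) x))) =
        Γ (D.toX₀ x) - Γ ((z : ℂ) ^ n • D.toX₀ ((D.T ^ n) x)) := by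
    intro n
    induction n with
    | zero => simp
    | succ n ih =>
      have h2 : (D.T ^ (n + 1)) x = D.T ((D.T ^ n) x) := by rw [pow_succ']; rfl
      have h3 := closedLoopObs_toX₀ i iStar hD hℰ z ((D.T ^ n) x)
      rw [Finset.sum_range_succ, ih, h2, map_smul, map_smul, map_smul, ← hΓ, ← hS] at *
      rw [h3, pow_succ, mul_smul, smul_add, smul_sub]
      abel
  have hsum : HasSum (fun k : ℕ =>
      (z : ℂ) ^ k • D.E ((D.T ^ k) x) - S z ((z : ℂ) ^ k • D.N ((D.T ^ k) x))) (D.F S z x) :=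
    (hD.analytic_E x z).hasSum.sub ((S z).hasSum (hD.analytic_N x z).hasSum)
  refine tendsto_nhds_unique ?_ hsum.tendsto_sum_nat
  simp_rw [hpart]
  have := (Γ.continuous.tendsto 0).comp (tendsto_pow_smul_toX₀ hD z x)
  rw [map_zero] at this
  simpa using this.const_sub (Γ (D.toX₀ x))

/-! ### Injectivity of the Redheffer transform -/

/-- The difference of two transforms factors as `G₁ (ℰ₁ - ℰ₂) L`. The factor `G₁` is cancelled on
the left by injectivity of `D₁₂`, then `L` on the right by density of the range of `D₂₁`. -/
lemma redheffer_injOn (hD : D.IsAdmissible) (hT : Function.Injective (adjoint D.T)) :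
    Set.InjOn (D.redheffer i iStar) (schurClass Δt Δst) := by
  intro ℰ₁ h₁ ℰ₂ h₂ heq
  have hol₁ : HoloDisk ℰ₁ := h₁.1
  have hol₂ : HoloDisk ℰ₂ := h₂.1
  set K : 𝔻 → Δst →L[ℂ] Δst := fun z => Ring.inverse (1 - ℰ₂ z ∘L D.Sigma₂₂ i iStar z) with hK
  -- This is `(I - Σ₂₂ ℰ₂)⁻¹ Σ₂₁`, written with the inverse of `I - ℰ₂ Σ₂₂`.
  set L : 𝔻 → U →L[ℂ] Δt := fun z => D.Sigma₂₁ i iStar z +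
    D.Sigma₂₂ i iStar z ∘L K z ∘L ℰ₂ z ∘L D.Sigma₂₁ i iStar z with hL
  have holK : HoloDisk K := .ringInverse
    ((HoloDisk.const 1).sub (hol₂.clm_comp (holoDisk_Sigma₂₂ i iStar hD)))
    (isUnit_one_sub_comp_Sigma₂₂ i iStar hD h₂)
  have holL : HoloDisk L := (holoDisk_Sigma₂₁ i iStar hD).add
    ((holoDisk_Sigma₂₂ i iStar hD).clm_comp
      (holK.clm_comp (hol₂.clm_comp (holoDisk_Sigma₂₁ i iStar hD))))
  have hL0 : L 0 = D.D₂₁ i iStar := by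
    simp only [hL, Sigma₂₁_zero, Sigma₂₂_zero, zero_comp, add_zero]
  have key : ∀ z, D.G i iStar ℰ₁ z ∘L (ℰ₁ z - ℰ₂ z) ∘L L z = 0 := by
    intro z
    ext u
    set t := D.Sigma₂₁ i iStar z u
    set d := K z (ℰ₂ z t) with hd
    have hLu : L z u = t + D.Sigma₂₂ i iStar z d := rfl
    have hdE : ℰ₂ z (L z u) = d := by
      have : d - ℰ₂ z (D.Sigma₂₂ i iStar z d) = ℰ₂ z t := DFunLike.congr_fun
        (Ring.mul_inverse_cancel _ (isUnit_one_sub_comp_Sigma₂₂ i iStar hD h₂ z)) (ℰ₂ z t)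
      rw [hLu, map_add, ← this, sub_add_cancel]
    have h3 := G_apply_sub i iStar hD h₁ z d
    have h4 : D.Sigma₁₁ i iStar z u + D.G i iStar ℰ₁ z (ℰ₁ z t) =
        D.Sigma₁₁ i iStar z u + D.Sigma₁₂ i iStar z d :=
      DFunLike.congr_fun (congrFun heq z) u
    rw [add_right_inj, ← h3, map_sub, eq_sub_iff_add_eq] at h4
    rw [comp_apply, comp_apply, sub_apply, hdE, map_sub, hLu, map_add, map_add, h4, sub_self,
      zero_apply]
  have step₁ : ∀ z, (ℰ₁ z - ℰ₂ z) ∘L L z = 0 :=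
    HoloDisk.eq_zero_of_bilin_eq_zero (compL ℂ U Δst Y) (holoDisk_G i iStar hD h₁)
      ((hol₁.sub hol₂).clm_comp holL) (fun Φ hΦ => by
        ext u
        refine G_zero_injective i iStar (ℰ := ℰ₁) hT ?_
        rw [zero_apply, map_zero]
        exact DFunLike.congr_fun hΦ u) key
  have step₂ : ∀ z, ℰ₁ z - ℰ₂ z = 0 :=
    HoloDisk.eq_zero_of_bilin_eq_zero (compL ℂ U Δt Δst).flip holL (hol₁.sub hol₂)
      (fun Φ hΦ => eq_zero_of_comp_D₂₁ i iStar (by rw [← hL0]; exact hΦ)) step₁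
  funext z
  exact sub_eq_zero.1 (step₂ z)

/-- If `P = M_F^* M_F` then the closed loop observability operator is isometric. -/
lemma adjoint_comp_self_eq_id (hD : D.IsAdmissible) {H : Type*} [NormedAddCommGroup H]
    [InnerProductSpace ℂ H] [CompleteSpace H] {M : D.X₀ →L[ℂ] H}
    (h : D.P = adjoint (M ∘L D.toX₀) ∘L (M ∘L D.toX₀)) : adjoint M ∘L M = .id ℂ D.X₀ := by
  refine (norm_map_iff_adjoint_comp_self M).1 fun x₀ => ?_
  refine denseRange_toX₀.induction (P := fun x₀ => ‖M x₀‖ = ‖x₀‖) ?_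
    (isClosed_eq (by fun_prop) (by fun_prop)) x₀
  rintro _ ⟨x, rfl⟩
  refine (sq_eq_sq₀ (norm_nonneg _) (norm_nonneg _)).1 ?_
  rw [← inner_toX₀_self hD, h, comp_apply, adjoint_inner_left, re_inner_self_eq_norm_sq]
  rfl

end Data

end AIP

end

theorem theoremT {X U Y Δt Δst : Type*}
    [NormedAddCommGroup X] [InnerProductSpace ℂ X] [CompleteSpace X]
    [NormedAddCommGroup U] [InnerProductSpace ℂ U] [CompleteSpace U]
    [NormedAddCommGroup Y] [InnerProductSpace ℂ Y] [CompleteSpace Y]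
    [NormedAddCommGroup Δt] [InnerProductSpace ℂ Δt] [CompleteSpace Δt]
    [NormedAddCommGroup Δst] [InnerProductSpace ℂ Δst] [CompleteSpace Δst]
    (D : AIP.Data X U Y) (hD : D.IsAdmissible)
    (i : D.Delta ≃ₗᵢ[ℂ] Δt) (iStar : D.DeltaStar ≃ₗᵢ[ℂ] Δst)
    (hT : Function.Injective (ContinuousLinearMap.adjoint D.T)) :
    -- the characteristic function and the Redheffer transform are well defined
    (∀ z : 𝔻, IsUnit (1 - (z : ℂ) • D.A i iStar)) ∧
    (∀ ℰ ∈ AIP.schurClass Δt Δst, ∀ z : 𝔻, IsUnit (1 - ℰ z ∘L D.Sigma₂₂ i iStar z)) ∧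
    Set.MapsTo (D.redheffer i iStar) (AIP.schurClass Δt Δst) (AIP.schurClass U Y) ∧
    -- the Redheffer transform is injective on the Schur class
    Set.InjOn (D.redheffer i iStar) (AIP.schurClass Δt Δst) ∧
    -- for each `ℰ`, with `S = ℛ_Σ[ℰ]`: the spaces `H(K_ℰ)` and `H(K_S)` exist, and so do the
    -- multiplication operators `M_G : H(K_ℰ) → H(K_S)` and `M_{F^S} : X → H(K_S)`
    ∀ ℰ ∈ AIP.schurClass Δt Δst,
      ∃ (_ : Fact (AIP.dbrKernel ℰ).PosSemidef)
        (_ : Fact (AIP.dbrKernel (D.redheffer i iStar ℰ)).PosSemidef)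
        (MG : RKHS.OfKernel (AIP.dbrKernel ℰ) →L[ℂ]
          RKHS.OfKernel (AIP.dbrKernel (D.redheffer i iStar ℰ)))
        (MF : X →L[ℂ] RKHS.OfKernel (AIP.dbrKernel (D.redheffer i iStar ℰ))),
        (∀ h, ∀ z : 𝔻, MG h z = D.G i iStar ℰ z (h z)) ∧
        (∀ x, ∀ z : 𝔻, MF x z = D.F (D.redheffer i iStar ℰ) z x) ∧
        LinearMap.ker (MG : RKHS.OfKernel (AIP.dbrKernel ℰ) →ₗ[ℂ]
          RKHS.OfKernel (AIP.dbrKernel (D.redheffer i iStar ℰ))) = ⊥ ∧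
        (D.P = ContinuousLinearMap.adjoint MF ∘L MF → Isometry MG) := by
  refine ⟨AIP.Data.isUnit_one_sub_smul_A i iStar hD,
    fun ℰ hℰ => AIP.Data.isUnit_one_sub_comp_Sigma₂₂ i iStar hD hℰ,
    fun ℰ hℰ => AIP.Data.redheffer_mem_schurClass i iStar hD hℰ,
    AIP.Data.redheffer_injOn i iStar hD hT, fun ℰ hℰ => ?_⟩
  have hS := AIP.Data.redheffer_mem_schurClass i iStar hD hℰ
  have fℰ : Fact (AIP.dbrKernel ℰ).PosSemidef := ⟨AIP.dbrKernel_posSemidef hℰ⟩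
  have fS : Fact (AIP.dbrKernel (D.redheffer i iStar ℰ)).PosSemidef :=
    ⟨AIP.dbrKernel_posSemidef hS⟩
  obtain ⟨MG, MΓ, hMG, hMΓ, hco⟩ := AIP.exists_multiplication_operators
    (H₁ := RKHS.OfKernel (AIP.dbrKernel ℰ))
    (H₂ := RKHS.OfKernel (AIP.dbrKernel (D.redheffer i iStar ℰ)))
    (G := D.G i iStar ℰ) (Γ := AIP.Data.closedLoopObs i iStar ℰ) (fun z ζ => by
      rw [RKHS.OfKernel.kernel_ofKernel, RKHS.OfKernel.kernel_ofKernel]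
      exact AIP.Data.dbrKernel_redheffer i iStar hD hℰ z ζ)
  -- If `G h = 0` with `h` holomorphic, injectivity of `G(0)` forces `h = 0`.
  have hinj : Function.Injective MG := by
    refine (injective_iff_map_eq_zero MG).2 fun h hh => ?_
    refine RKHS.ext fun z => ?_
    rw [RKHS.coe_zero]
    refine AIP.HoloDisk.eq_zero_of_bilin_eq_zero (.id ℂ (Δst →L[ℂ] Y))
      (AIP.Data.holoDisk_G i iStar hD hℰ)
      (AIP.holoDisk_of_kernel_eq_dbrKernel hℰ RKHS.OfKernel.kernel_ofKernel h)
      (fun v hv => AIP.Data.G_zero_injective i iStar (ℰ := ℰ) hT (hv.trans (map_zero _).symm))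
      (fun z => ?_) z
    have := hMG h z
    rw [hh, RKHS.coe_zero] at this
    exact this.symm
  -- `M_{F^S}` is taken to be `M_Γ P^{1/2}`, so that the extra hypothesis on `P` becomes isometry of
  -- `M_Γ` on `X₀`.
  refine ⟨fℰ, fS, MG, MΓ ∘L D.toX₀, hMG, fun x z => ?_, LinearMap.ker_eq_bot.2 hinj, fun hP => ?_⟩
  · rw [ContinuousLinearMap.comp_apply, hMΓ]
    exact AIP.Data.closedLoopObs_toX₀_eq_F i iStar hD hℰ z x
  · exact AIP.isometry_of_coisometry hco (AIP.Data.adjoint_comp_self_eq_id hD hP) hinj
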